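/- There are $m\ge 1$ disjoint communities $C_1,\dots,C_m$ with $|C_i|=d_i\ge 1$ members, and $\mu_i=1/d_i$. Every exploration of $C_i$ meets a uniformly random member of $C_i$, independently of everything else; $\Phi(i,\tau)$ denotes the member met in the $\tau$-th exploration of $C_i$ in a round. Each round has a budget of $K>m$ explorations. For an allocation $\boldsymbol k=(k_1,\dots,k_m)$ of non-negative integers let $R(\boldsymbol k,\Phi)=\sum_i|\{\Phi(i,1),\dots,\Phi(i,k_i)\}|$ and $r_{\boldsymbol k}(\boldsymbol\mu)=\mathbb E[R(\boldsymbol k,\Phi)]$, and let $\boldsymbol k^*$ maximize $r_{\boldsymbol k}(\boldsymbol\mu)$ over all $\boldsymbol k$ with $\sum_i k_i\le K$. The CLCB algorithm with non-adaptive exploration does not know the $d_i$. It starts with $T_i=X_i=0$ and $\hat\mu_i=0$ for all $i$. In round $t=1,2,\dots$ it sets $\rho_i=\sqrt{3\ln t/(2T_i)}$ ($\rho_i=0$ if $T_i=0$) and $\underline\mu_i=\max\{0,\hat\mu_i-\rho_i\}$, and computes an allocation $\boldsymbol k_t$ greedily: starting from $\boldsymbol k=0$, it $K$ times increases $k_{i}$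 by one for a uniformly random $i\in\arg\max_j(1-\underline\mu_j)^{k_j}$. It then explores each $C_i$ exactly $k_{i,t}$ times (with a fresh realization $\Phi_t$), adds $\lfloor k_{i,t}/2\rfloor$ to $T_i$, adds to $X_i$ the number of $x\in\{1,\dots,\lfloor k_{i,t}/2\rfloor\}$ for which the $(2x-1)$-st and the $2x$-th member met in $C_i$ in this round coincide, and sets $\hat\mu_i=X_i/T_i$ if $k_{i,t}>1$. Its regret is $$\mathrm{Reg}_{\boldsymbol\mu}(T)=\mathbb E\Big[\sum_{t=1}^T\big(R(\boldsymbol k^*,\Phi_t)-R(\boldsymbol k_t,\Phi_t)\big)\Big].$$ For $\boldsymbol k$ with $\sum_ik_i=K$ let $\Delta_{\boldsymbol k}=r_{\boldsymbol k^*}(\boldsymbol\mu)-r_{\boldsymbol k}(\boldsymbol\mu)$. Let $\Delta^i_{\min}$ and $\Delta^i_{\max}$ be the minimum and the maximum of $\Delta_{\boldsymbol k}$ over all such $\boldsymbol k$ with $\Delta_{\boldsymbol k}>0$ and $k_i>1$ ($\Delta^i_{\min}=\infty$ and $\Delta^i_{\max}=0$ if there are none), let $\Delta_{\max}=\max_i\Delta^i_{\max}$,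 and let $K'=K-m+1$. Theorem. For every $T\ge1$, $$\mathrm{Reg}_{\boldsymbol\mu}(T)\le\sum_{i=1}^m\frac{48\binom{K'}2K\ln T}{\Delta^i_{\min}}+2\binom{K'}2m+\frac{\lfloor K'/2\rfloor\pi^2}{3}\,m\,\Delta_{\max}.$$ Moreover $\mathrm{Reg}_{\boldsymbol\mu}(T)=O\big(\sum_{i=1}^mK'^3\log T/\Delta^i_{\min}\big)$ as $T\to\infty$ with an absolute implied constant: there is a constant $C>0$, independent of $m$, $K$ and $d_1,\dots,d_m$, such that for all $m,K,d_1,\dots,d_m$ as above one has $\mathrm{Reg}_{\boldsymbol\mu}(T)\le C\sum_{i=1}^mK'^3\ln T/\Delta^i_{\min}$ for all sufficiently large $T$ (how large may depend on $m,K,d_1,\dots,d_m$). -/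

import Mathlib

namespace CommunityExploration

/-! ### Exploration of communities

There are `m` disjoint communities; the `i`-th one has `d i` members, labelled by `Fin (d i)`.
In every round there is a budget of `K` explorations. -/

/-- A realization: `φ i τ` is the member of community `i` that is met in the `(τ + 1)`-st
exploration of that community. -/
abbrev Realization {m : ℕ} (d : Fin m → ℕ+) (K : ℕ) : Type :=
  (i : Fin m) → Fin K → Fin (d i : ℕ)

/-- The law of the random realization: all the entries `Φ i τ` are independent, and `Φ i τ` is
uniformly distributed on community `i`; that is, `Φ` is uniform on the product. -/
noncomputable def realizationLaw {m : ℕ} (d : Fin m → ℕ+) (K : ℕ) : PMF (Realization d K) :=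
  PMF.uniformOfFintype (Realization d K)

/-- The expectation of a real function under a discrete law. (All the laws below have finite
support, so that the sum has only finitely many nonzero terms.) -/
noncomputable def expectation {α : Type} (p : PMF α) (f : α → ℝ) : ℝ :=
  ∑' a, (p a).toReal * f a

/-- The reward `R(k, φ)`: the number of distinct members met when community `i` is explored
`k i` times. -/
def reward {m : ℕ} {d : Fin m → ℕ+} {K : ℕ} (k : Fin m → ℕ) (φ : Realization d K) : ℕ :=
  ∑ i, ((Finset.univ.filter fun τ : Fin K => (τ : ℕ) < k i).image (φ i)).card

/-- The expected reward `r_k(μ)` of the budget allocation `k`. -/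
noncomputable def expectedReward {m : ℕ} (d : Fin m → ℕ+) (K : ℕ) (k : Fin m → ℕ) : ℝ :=
  expectation (realizationLaw d K) fun φ => (reward k φ : ℝ)

/-- `k` maximizes the expected reward among all the allocations of a budget of at most `K`. -/
def IsOptimalAllocation {m : ℕ} (d : Fin m → ℕ+) (K : ℕ) (k : Fin m → ℕ) : Prop :=
  ∑ i, k i ≤ K ∧
    ∀ k' : Fin m → ℕ, ∑ i, k' i ≤ K → expectedReward d K k' ≤ expectedReward d K k

/-! ### The greedy budget allocation -/

open scoped Classical in
/-- The set of maximizers `i` of `(1 - μ i) ^ k i`. -/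
noncomputable def argmaxSet {m : ℕ} (μ : Fin m → ℝ) (k : Fin m → ℕ) : Finset (Fin m) :=
  Finset.univ.filter fun i => ∀ j, (1 - μ j) ^ k j ≤ (1 - μ i) ^ k i

theorem argmaxSet_nonempty {m : ℕ} [NeZero m] (μ : Fin m → ℝ) (k : Fin m → ℕ) :
    (argmaxSet μ k).Nonempty := by
  obtain ⟨i, hi⟩ := Finite.exists_max fun i => (1 - μ i) ^ k i
  exact ⟨i, by simpa [argmaxSet] using hi⟩

/-- The (random) allocation after `s` steps of the greedy method with parameters `μ`: starting
from `0`, each step adds one unit to a uniformly random maximizer of `(1 - μ i) ^ k i`. -/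
noncomputable def greedyAllocation {m : ℕ} [NeZero m] (μ : Fin m → ℝ) : ℕ → PMF (Fin m → ℕ)
  | 0 => PMF.pure fun _ => 0
  | s + 1 => (greedyAllocation μ s).bind fun k =>
      (PMF.uniformOfFinset (argmaxSet μ k) (argmaxSet_nonempty μ k)).map fun i =>
        Function.update k i (k i + 1)

/-! ### The CLCB algorithm with non-adaptive exploration -/

/-- What happened in the past rounds, the most recent round first: each entry is the
allocation that was played together with the realization of that round. -/
abbrev History {m : ℕ} (d : Fin m → ℕ+) (K : ℕ) : Type :=
  List ((Fin m → ℕ) × Realization d K)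

/-- The number of collisions among the disjoint pairs (1st, 2nd), (3rd, 4th), … of the
members `φ i 0, …, φ i (k i - 1)` of community `i` met in one round; there are `k i / 2` such
pairs (rounded down). -/
def collisions {m : ℕ} {d : Fin m → ℕ+} {K : ℕ} (k : Fin m → ℕ) (φ : Realization d K)
    (i : Fin m) : ℕ :=
  (Finset.univ.filter fun p : Fin K × Fin K =>
    Even (p.1 : ℕ) ∧ (p.2 : ℕ) = (p.1 : ℕ) + 1 ∧ (p.2 : ℕ) < k i ∧ φ i p.1 = φ i p.2).card

/-- `T_i`: the number of pairs of members of community `i` that were observed so far. -/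
def pairCount {m : ℕ} {d : Fin m → ℕ+} {K : ℕ} (h : History d K) (i : Fin m) : ℕ :=
  (h.map fun r => r.1 i / 2).sum

/-- `X_i`: the number of collisions in community `i` that were observed so far. -/
def collisionCount {m : ℕ} {d : Fin m → ℕ+} {K : ℕ} (h : History d K) (i : Fin m) : ℕ :=
  (h.map fun r => collisions r.1 r.2 i).sum

/-- The empirical mean `X_i / T_i`; it keeps its initial value `0` while `T_i = 0`. -/
noncomputable def empiricalMean {m : ℕ} {d : Fin m → ℕ+} {K : ℕ} (h : History d K)
    (i : Fin m) : ℝ :=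
  if pairCount h i = 0 then 0 else (collisionCount h i : ℝ) / (pairCount h i : ℝ)

/-- The confidence radius in round `t`, where `h` is the history before round `t`. -/
noncomputable def confidenceRadius {m : ℕ} {d : Fin m → ℕ+} {K : ℕ} (t : ℕ) (h : History d K)
    (i : Fin m) : ℝ :=
  if pairCount h i = 0 then 0 else Real.sqrt (3 * Real.log t / (2 * (pairCount h i : ℝ)))

/-- The lower confidence bound used in round `t`. -/
noncomputable def lowerConfidenceBound {m : ℕ} {d : Fin m → ℕ+} {K : ℕ} (t : ℕ)
    (h : History d K) (i : Fin m) : ℝ :=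
  max 0 (empiricalMean h i - confidenceRadius t h i)

/-- The law of the history after `t` rounds of the CLCB algorithm. In round `t + 1` the greedy
method distributes the budget `K` on the basis of the lower confidence bounds, and then an
independent realization is drawn. -/
noncomputable def clcbHistory {m : ℕ} [NeZero m] (d : Fin m → ℕ+) (K : ℕ) :
    ℕ → PMF (History d K)
  | 0 => PMF.pure []
  | t + 1 => (clcbHistory d K t).bind fun h =>
      (greedyAllocation (lowerConfidenceBound (t + 1) h) K).bind fun k =>
        (realizationLaw d K).map fun φ => (k, φ) :: h

/-- The `T`-round regret of the CLCB algorithm with respect to the allocation `kstar`: the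
expectation of the sum over the rounds `t = 1, …, T` of `R(kstar, Φ_t) - R(k_t, Φ_t)`. -/
noncomputable def regret {m : ℕ} [NeZero m] (d : Fin m → ℕ+) (K : ℕ) (kstar : Fin m → ℕ)
    (T : ℕ) : ℝ :=
  expectation (clcbHistory d K T) fun h =>
    (h.map fun r => (reward kstar r.2 : ℝ) - (reward r.1 r.2 : ℝ)).sum

/-! ### Gaps -/

/-- The gap `Δ_k = r_{kstar}(μ) - r_k(μ)` of the action `k`. -/
noncomputable def gap {m : ℕ} (d : Fin m → ℕ+) (K : ℕ) (kstar k : Fin m → ℕ) : ℝ :=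
  expectedReward d K kstar - expectedReward d K k

/-- The actions `k` (with `∑ k i = K`) with a positive gap that explore community `i` more than
once. -/
def badActions {m : ℕ} (d : Fin m → ℕ+) (K : ℕ) (kstar : Fin m → ℕ) (i : Fin m) :
    Set (Fin m → ℕ) :=
  {k | ∑ j, k j = K ∧ 0 < gap d K kstar k ∧ 1 < k i}

/-- `Δ^i_min`, the least gap of an action in `badActions`; it is `∞` if there is none. -/
noncomputable def gapMin {m : ℕ} (d : Fin m → ℕ+) (K : ℕ) (kstar : Fin m → ℕ) (i : Fin m) :
    ENNReal :=
  sInf ((fun k => ENNReal.ofReal (gap d K kstar k)) '' badActions d K kstar i)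

/-- `Δ^i_max`, the greatest gap of an action in `badActions` (a finite set); it is `0` if there
is none. -/
noncomputable def gapMaxAt {m : ℕ} (d : Fin m → ℕ+) (K : ℕ) (kstar : Fin m → ℕ) (i : Fin m) :
    ℝ :=
  sSup (gap d K kstar '' badActions d K kstar i)

/-- `Δ_max = max_i Δ^i_max`. -/
noncomputable def gapMax {m : ℕ} (d : Fin m → ℕ+) (K : ℕ) (kstar : Fin m → ℕ) : ℝ :=
  ⨆ i, gapMaxAt d K kstar i

/-- `1 / Δ^i_min` as a real number; it is `0` if `Δ^i_min = ∞`. -/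
noncomputable def invGapMin {m : ℕ} (d : Fin m → ℕ+) (K : ℕ) (kstar : Fin m → ℕ) (i : Fin m) :
    ℝ :=
  ((gapMin d K kstar i)⁻¹).toReal

end CommunityExploration

/-!
Observed pairs of members of `C_i` coincide with probability `μ_i`, independently, so by Hoeffding's
lemma `exp (l (X_i - μ_i T_i) - l² T_i / 8)` is a supermartingale, and Ville's inequality yields
the confidence intervals. Let `κ = K - m + 1`. The expected number of rounds in which some interval
fails is at most `3 m ⌊κ / 2⌋`, where `3 ≤ π² / 3`.

Suppose that all the intervals hold. The greedy allocation maximizes the reward with parameters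
`LCB_i ≤ μ_i`, which overestimates the true reward; hence the gap is at most the overestimation of
the reward of the played allocation, summed over the communities.

* If all the lower confidence bounds are positive, every community is explored at least once, so
  that `k_i ≤ κ`. The gap is charged to the observed pairs: a unit of community `i` beyond the
  first one pays `κ` times the estimation error, which is of order `√(ln T / T_i)`, minus an equal
  share of the gap. Summing over `T_i` gives at most `κ² + 12 κ² (κ - 1) ln T / Δ^i_min`.
* If some lower confidence bound vanishes, only communities with this property are explored more
  than once, and `T_i ≤ 6 ln T / μ_i²` for these. This costs at most `6 K ln T / μ_i + K` per
  community, and `1 / μ_i ≤ κ / Δ^i_min`: when units are moved one by one to `C_i`, starting from an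
  optimal allocation, the first suboptimal allocation has a gap of at most `κ μ_i`.

For the asymptotic bound it remains to see that the expected number of rounds of the second kind is
`o(ln T)`. It is `O(ln T)` on every path. Let `6 η ≤ min μ_i`. Outside an event of probability
`2 m exp (-2 η² w)`, no mean of at least `w` observations ever deviates by `η`; then in every late
window some round explores only well-explored communities more than once, and since this round is
greedy, all the lower confidence bounds are at least `4 η` in it and stay positive afterwards, so
that only boundedly many rounds are of the second kind. As `w` is arbitrary, the claim follows.
-/

namespace CommunityExploration

section Expectation

variable {α β : Type} {p : PMF α}

theorem expectation_eq_sum {s : Finset α} (hs : p.support ⊆ s) (f : α → ℝ) :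
    expectation p f = ∑ a ∈ s, (p a).toReal * f a := by
  refine tsum_eq_sum fun a ha => ?_
  have hpa : p a = 0 := (p.apply_eq_zero_iff a).2 fun h => ha (hs h)
  simp [hpa]

theorem sum_toReal_eq_one {s : Finset α} (hs : p.support ⊆ s) :
    ∑ a ∈ s, (p a).toReal = 1 := by
  have htsum : ∑' a, p a = ∑ a ∈ s, p a :=
    tsum_eq_sum fun a ha => (p.apply_eq_zero_iff a).2 fun h => ha (hs h)
  rw [← ENNReal.toReal_sum fun a _ => p.apply_ne_top a, ← htsum, p.tsum_coe, ENNReal.toReal_one]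

theorem expectation_const_mul (p : PMF α) (c : ℝ) (f : α → ℝ) :
    expectation p (fun a => c * f a) = c * expectation p f := by
  simp only [expectation, mul_left_comm, tsum_mul_left]

theorem expectation_mul_const (p : PMF α) (c : ℝ) (f : α → ℝ) :
    expectation p (fun a => f a * c) = expectation p f * c := by
  simp only [mul_comm _ c, expectation_const_mul]

theorem expectation_mono (hp : p.support.Finite) {f g : α → ℝ}
    (h : ∀ a ∈ p.support, f a ≤ g a) : expectation p f ≤ expectation p g := by
  have hs : p.support ⊆ hp.toFinset := by simp
  rw [expectation_eq_sum hs, expectation_eq_sum hs]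
  exact Finset.sum_le_sum fun a ha =>
    mul_le_mul_of_nonneg_left (h a (by simpa using ha)) ENNReal.toReal_nonneg

theorem expectation_congr (hp : p.support.Finite) {f g : α → ℝ}
    (h : ∀ a ∈ p.support, f a = g a) : expectation p f = expectation p g :=
  le_antisymm (expectation_mono hp fun a ha => (h a ha).le)
    (expectation_mono hp fun a ha => (h a ha).ge)

theorem expectation_sum {ι : Type} (hp : p.support.Finite) (s : Finset ι) (f : ι → α → ℝ) :
    expectation p (fun a => ∑ i ∈ s, f i a) = ∑ i ∈ s, expectation p (f i) := by
  have hs : p.support ⊆ hp.toFinset := by simp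
  simp_rw [expectation_eq_sum hs, Finset.mul_sum]
  exact Finset.sum_comm

theorem expectation_add (hp : p.support.Finite) (f g : α → ℝ) :
    expectation p (fun a => f a + g a) = expectation p f + expectation p g := by
  have hs : p.support ⊆ hp.toFinset := by simp
  simp_rw [expectation_eq_sum hs, mul_add, Finset.sum_add_distrib]

theorem expectation_sub (hp : p.support.Finite) (f g : α → ℝ) :
    expectation p (fun a => f a - g a) = expectation p f - expectation p g := by
  have hs : p.support ⊆ hp.toFinset := by simp
  simp_rw [expectation_eq_sum hs, mul_sub, Finset.sum_sub_distrib]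

theorem expectation_const (hp : p.support.Finite) (c : ℝ) :
    expectation p (fun _ => c) = c := by
  have hs : p.support ⊆ hp.toFinset := by simp
  rw [expectation_eq_sum hs, ← Finset.sum_mul, sum_toReal_eq_one hs, one_mul]

theorem expectation_pure (a : α) (f : α → ℝ) : expectation (PMF.pure a) f = f a := by
  rw [expectation_eq_sum (s := {a}) (by simp)]
  simp

theorem finite_support_bind (hp : p.support.Finite) {q : α → PMF β}
    (hq : ∀ a, (q a).support.Finite) : (p.bind q).support.Finite := by
  rw [PMF.support_bind]
  exact hp.biUnion fun a _ => hq a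

theorem finite_support_map (hp : p.support.Finite) (f : α → β) : (p.map f).support.Finite := by
  rw [PMF.support_map]
  exact hp.image f

theorem toReal_bind_apply (p : PMF α) (q : α → PMF β) (b : β) :
    (p.bind q b).toReal = expectation p fun a => (q a b).toReal := by
  rw [PMF.bind_apply, ENNReal.tsum_toReal_eq fun a =>
    ENNReal.mul_ne_top (p.apply_ne_top a) ((q a).apply_ne_top b)]
  simp only [ENNReal.toReal_mul, expectation]

theorem expectation_bind (hp : p.support.Finite) {q : α → PMF β}
    (hq : ∀ a, (q a).support.Finite) (f : β → ℝ) :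
    expectation (p.bind q) f = expectation p fun a => expectation (q a) f := by
  have hb := finite_support_bind hp hq
  have hbs : (p.bind q).support ⊆ hb.toFinset := by simp
  have hqs : ∀ a ∈ p.support, (q a).support ⊆ hb.toFinset := fun a ha b hbq => by
    simpa using ⟨a, by simpa using ha, by simpa using hbq⟩
  calc expectation (p.bind q) f
      = ∑ b ∈ hb.toFinset, expectation p fun a => (q a b).toReal * f b := by
        simp_rw [expectation_eq_sum hbs, toReal_bind_apply, expectation_mul_const]
    _ = expectation p fun a => ∑ b ∈ hb.toFinset, (q a b).toReal * f b :=
        (expectation_sum hp _ _).symm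
    _ = expectation p fun a => expectation (q a) f :=
        expectation_congr hp fun a ha => (expectation_eq_sum (hqs a ha) f).symm

theorem expectation_map (hp : p.support.Finite) (g : α → β) (f : β → ℝ) :
    expectation (p.map g) f = expectation p fun a => f (g a) := by
  rw [← PMF.bind_pure_comp, expectation_bind hp fun a => by simp]
  simp only [Function.comp_apply, expectation_pure]

open scoped BigOperators in
theorem expectation_uniformOfFintype [Fintype α] [Nonempty α] (f : α → ℝ) :
    expectation (PMF.uniformOfFintype α) f = 𝔼 a, f a := by
  rw [expectation_eq_sum (s := Finset.univ) (by simp), Fintype.expect_eq_sum_div_card]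
  simp [div_eq_inv_mul, Finset.mul_sum]

end Expectation

section Probability

variable {α : Type} {p : PMF α}

/-- The probability of an event under a discrete law, as a real number; like `expectation`, it is
meant for laws with finite support. -/
noncomputable def probability (p : PMF α) (A : Set α) : ℝ :=
  expectation p (A.indicator 1)

theorem probability_nonneg (p : PMF α) (A : Set α) : 0 ≤ probability p A :=
  tsum_nonneg fun a =>
    mul_nonneg ENNReal.toReal_nonneg (Set.indicator_nonneg (fun _ _ => zero_le_one) a)

theorem probability_le_one (hp : p.support.Finite) (A : Set α) : probability p A ≤ 1 :=
  (expectation_mono hp fun _ _ => Set.indicator_le_self' (fun _ _ => zero_le_one) _).trans_eq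
    (expectation_const hp 1)

theorem probability_le_sum {ι : Type} (hp : p.support.Finite) {A : Set α} {s : Finset ι}
    {B : ι → Set α} (h : ∀ a ∈ p.support, a ∈ A → ∃ i ∈ s, a ∈ B i) :
    probability p A ≤ ∑ i ∈ s, probability p (B i) := by
  have hnonneg : ∀ i a, 0 ≤ (B i).indicator (1 : α → ℝ) a := fun i a =>
    Set.indicator_nonneg (fun _ _ => zero_le_one) a
  unfold probability
  rw [← expectation_sum hp]
  refine expectation_mono hp fun a ha => ?_
  by_cases hA : a ∈ A
  · obtain ⟨i, hi, hB⟩ := h a ha hA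
    refine le_trans ?_ (Finset.single_le_sum (fun i _ => hnonneg i a) hi)
    simp [hA, hB]
  · simpa [hA] using Finset.sum_nonneg fun i _ => hnonneg i a

end Probability

section GeomReward

/-- The expected number of distinct members met in `k` explorations of a community in which two
uniformly random members coincide with probability `x`. -/
noncomputable def geomReward (x : ℝ) (k : ℕ) : ℝ := ∑ j ∈ Finset.range k, (1 - x) ^ j

variable {x y : ℝ}

theorem geomReward_succ (x : ℝ) (k : ℕ) :
    geomReward x (k + 1) = geomReward x k + (1 - x) ^ k :=
  Finset.sum_range_succ _ _

theorem geomReward_nonneg (hx : x ≤ 1) (k : ℕ) : 0 ≤ geomReward x k :=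
  Finset.sum_nonneg fun j _ => pow_nonneg (sub_nonneg.2 hx) j

theorem geomReward_le (h0 : 0 ≤ x) (h1 : x ≤ 1) (k : ℕ) : geomReward x k ≤ k := by
  simpa [geomReward] using Finset.sum_le_card_nsmul (Finset.range k) (fun j => (1 - x) ^ j) 1
    fun j _ => pow_le_one₀ (sub_nonneg.2 h1) (sub_le_self 1 h0)

theorem geomReward_anti (hxy : x ≤ y) (hy : y ≤ 1) (k : ℕ) : geomReward y k ≤ geomReward x k :=
  Finset.sum_le_sum fun j _ => pow_le_pow_left₀ (sub_nonneg.2 hy) (sub_le_sub_left hxy 1) j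

theorem one_sub_pow_sub_one_sub_pow_le (hx : 0 ≤ x) (hxy : x ≤ y) (hy : y ≤ 1) (j : ℕ) :
    (1 - x) ^ j - (1 - y) ^ j ≤ j * (y - x) := by
  induction j with
  | zero => simp
  | succ j ih =>
    have hle : (1 - x) ^ j ≤ 1 := pow_le_one₀ (by linarith) (by linarith)
    have hdiff : 0 ≤ (1 - x) ^ j - (1 - y) ^ j :=
      sub_nonneg.2 (pow_le_pow_left₀ (by linarith) (by linarith) j)
    calc (1 - x) ^ (j + 1) - (1 - y) ^ (j + 1)
        = (1 - x) ^ j * (y - x) + ((1 - x) ^ j - (1 - y) ^ j) * (1 - y) := by ring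
      _ ≤ 1 * (y - x) + ((1 - x) ^ j - (1 - y) ^ j) * 1 := by gcongr; linarith
      _ ≤ (j + 1 : ℕ) * (y - x) := by push_cast; linarith

theorem geomReward_sub_geomReward_le (hx : 0 ≤ x) (hxy : x ≤ y) (hy : y ≤ 1) (k : ℕ) :
    geomReward x k - geomReward y k ≤ (k : ℝ) * (k - 1) / 2 * (y - x) := by
  induction k with
  | zero => simp [geomReward]
  | succ k ih =>
    have hpow := one_sub_pow_sub_one_sub_pow_le hx hxy hy k
    simp only [geomReward_succ]
    push_cast
    linarith

theorem geomReward_sub_le_mul {v : ℝ} (h0 : 0 ≤ x) (h1 : x ≤ 1) {a b : ℕ}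
    (hup : (1 - x) ^ a ≤ v) (hlo : 0 < a → v ≤ (1 - x) ^ (a - 1)) :
    geomReward x b - geomReward x a ≤ v * ((b : ℝ) - a) := by
  have hanti : ∀ {i j : ℕ}, i ≤ j → (1 - x) ^ j ≤ (1 - x) ^ i := fun hij =>
    pow_le_pow_of_le_one (sub_nonneg.2 h1) (sub_le_self 1 h0) hij
  unfold geomReward
  rcases le_total a b with hab | hba
  · have hsum := Finset.sum_le_card_nsmul (Finset.Ico a b) (fun j => (1 - x) ^ j) v fun j hj =>
      (hanti (Finset.mem_Ico.1 hj).1).trans hup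
    rw [Nat.card_Ico, nsmul_eq_mul, Nat.cast_sub hab] at hsum
    rw [← Finset.sum_range_add_sum_Ico _ hab]
    linarith
  · have hsum := Finset.card_nsmul_le_sum (Finset.Ico b a) (fun j => (1 - x) ^ j) v fun j hj =>
      (hlo (pos_of_gt (Finset.mem_Ico.1 hj).2)).trans
        (hanti (Nat.le_sub_one_of_lt (Finset.mem_Ico.1 hj).2))
    rw [Nat.card_Ico, nsmul_eq_mul, Nat.cast_sub hba] at hsum
    rw [← Finset.sum_range_add_sum_Ico _ hba]
    linarith

end GeomReward

section Counting

variable {ι : Type*} [Fintype ι] {k : ι → ℕ}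

theorem exists_one_lt_of_card_lt_sum (h : Fintype.card ι < ∑ i, k i) : ∃ i, 1 < k i := by
  obtain ⟨i, -, hi⟩ := Finset.exists_lt_of_sum_lt (s := Finset.univ) (f := fun _ : ι => 1)
    (g := k) (by simpa using h)
  exact ⟨i, hi⟩

theorem add_card_le_sum_add_one (h : ∀ i, 1 ≤ k i) (i : ι) :
    k i + Fintype.card ι ≤ ∑ j, k j + 1 := by
  classical
  have hothers : (Finset.univ.erase i).card ≤ ∑ j ∈ Finset.univ.erase i, k j := by
    simpa using Finset.card_nsmul_le_sum (Finset.univ.erase i) k 1 fun j _ => h j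
  have hcard : 0 < Fintype.card ι := Fintype.card_pos_iff.2 ⟨i⟩
  rw [Finset.card_erase_of_mem (Finset.mem_univ i), Finset.card_univ] at hothers
  rw [← Finset.add_sum_erase _ k (Finset.mem_univ i)]
  omega

end Counting

section Greedy

/-- The local optimality condition satisfied by greedy allocations: with respect to the
parameters `μ`, no unit of `k` could be moved to a place where it earns more. -/
def IsGreedy {ι : Type*} (μ : ι → ℝ) (k : ι → ℕ) : Prop :=
  ∀ i j, 0 < k i → (1 - μ j) ^ k j ≤ (1 - μ i) ^ (k i - 1)

variable {ι : Type*} {μ : ι → ℝ} {k : ι → ℕ}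

theorem IsGreedy.add_single [DecidableEq ι] (hk : IsGreedy μ k) (h0 : ∀ i, 0 ≤ μ i)
    (h1 : ∀ i, μ i ≤ 1) {i : ι} (hi : ∀ j, (1 - μ j) ^ k j ≤ (1 - μ i) ^ k i) :
    IsGreedy μ (k + Pi.single i 1) := by
  intro a b ha
  have hb : (1 - μ b) ^ (k + Pi.single i 1 : ι → ℕ) b ≤ (1 - μ b) ^ k b :=
    pow_le_pow_of_le_one (sub_nonneg.2 (h1 b)) (sub_le_self 1 (h0 b)) (by simp)
  refine hb.trans ?_
  rcases eq_or_ne a i with rfl | hai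
  · simpa using hi b
  · simpa [hai] using hk a b (by simpa [hai] using ha)

theorem IsGreedy.sum_geomReward_le [Fintype ι] [Nonempty ι] (hk : IsGreedy μ k)
    (h0 : ∀ i, 0 ≤ μ i) (h1 : ∀ i, μ i ≤ 1) {k' : ι → ℕ} (hle : ∑ i, k' i ≤ ∑ i, k i) :
    ∑ i, geomReward (μ i) (k' i) ≤ ∑ i, geomReward (μ i) (k i) := by
  obtain ⟨i₀, hi₀⟩ := Finite.exists_max fun i => (1 - μ i) ^ k i
  have hcast : (∑ i, (k' i : ℝ)) - ∑ i, (k i : ℝ) ≤ 0 := sub_nonpos.2 (by exact_mod_cast hle)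
  rw [← sub_nonpos]
  calc ∑ i, geomReward (μ i) (k' i) - ∑ i, geomReward (μ i) (k i)
      ≤ ∑ i, (1 - μ i₀) ^ k i₀ * ((k' i : ℝ) - k i) := by
        rw [← Finset.sum_sub_distrib]
        exact Finset.sum_le_sum fun i _ =>
          geomReward_sub_le_mul (h0 i) (h1 i) (hi₀ i) (hk i i₀)
    _ = (1 - μ i₀) ^ k i₀ * ((∑ i, (k' i : ℝ)) - ∑ i, (k i : ℝ)) := by
        rw [← Finset.mul_sum, Finset.sum_sub_distrib]
    _ ≤ 0 := mul_nonpos_of_nonneg_of_nonpos (pow_nonneg (sub_nonneg.2 (h1 i₀)) _) hcast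

theorem IsGreedy.le_one_of_one_le (hk : IsGreedy μ k) {i j : ι} (hi0 : 0 < μ i) (hi1 : μ i ≤ 1)
    (hj : 1 ≤ (1 - μ j) ^ k j) : k i ≤ 1 := by
  by_contra! hi
  have hlt : (1 - μ i) ^ (k i - 1) < 1 :=
    pow_lt_one₀ (sub_nonneg.2 hi1) (sub_lt_self 1 hi0) (by omega)
  exact (hj.trans (hk i j (by omega))).not_gt hlt

theorem IsGreedy.le_one_of_eq_zero (hk : IsGreedy μ k) {i j : ι} (hi0 : 0 < μ i) (hi1 : μ i ≤ 1)
    (hj : μ j = 0) : k i ≤ 1 :=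
  hk.le_one_of_one_le hi0 hi1 (j := j) (by simp [hj])

theorem IsGreedy.one_le [Fintype ι] (hk : IsGreedy μ k) (h0 : ∀ i, 0 < μ i) (h1 : ∀ i, μ i ≤ 1)
    (hcard : Fintype.card ι ≤ ∑ i, k i) (i : ι) : 1 ≤ k i := by
  by_contra! hi
  have hle : ∀ j, k j ≤ 1 := fun j =>
    hk.le_one_of_one_le (h0 j) (h1 j) (j := i) (by simp [Nat.lt_one_iff.1 hi])
  have hlt : ∑ j, k j < ∑ _j : ι, 1 :=
    Finset.sum_lt_sum (fun j _ => hle j) ⟨i, Finset.mem_univ i, hi⟩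
  rw [Finset.sum_const, Finset.card_univ, smul_eq_mul, mul_one] at hlt
  exact hlt.not_ge hcard

theorem IsGreedy.le_of_eq_one_of_one_lt (hk : IsGreedy μ k) {i j : ι} (h0 : 0 ≤ μ j)
    (h1 : μ j ≤ 1) (hi : k i = 1) (hj : 1 < k j) : μ j ≤ μ i := by
  have hij : 1 - μ i ≤ (1 - μ j) ^ (k j - 1) := by simpa [hi] using hk j i (by omega)
  have hpow : (1 - μ j) ^ (k j - 1) ≤ 1 - μ j :=
    pow_le_of_le_one (sub_nonneg.2 h1) (sub_le_self 1 h0) (by omega)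
  linarith

end Greedy

section GreedyAllocation

variable {m : ℕ} [NeZero m] {μ : Fin m → ℝ} {s : ℕ} {k : Fin m → ℕ}

theorem finite_support_greedyAllocation (μ : Fin m → ℝ) (s : ℕ) :
    (greedyAllocation μ s).support.Finite := by
  induction s with
  | zero => simp [greedyAllocation]
  | succ s ih => exact finite_support_bind ih fun k => finite_support_map (by simp) _

theorem mem_support_greedyAllocation_succ :
    k ∈ (greedyAllocation μ (s + 1)).support ↔ ∃ k' ∈ (greedyAllocation μ s).support,
      ∃ i, (∀ j, (1 - μ j) ^ k' j ≤ (1 - μ i) ^ k' i) ∧ k = k' + Pi.single i 1 := by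
  have hupdate : ∀ (k' : Fin m → ℕ) i, Function.update k' i (k' i + 1) = k' + Pi.single i 1 := by
    intro k' i
    ext j
    rcases eq_or_ne j i with rfl | hji <;> simp [*]
  simp only [greedyAllocation, hupdate, PMF.mem_support_bind_iff, PMF.mem_support_map_iff,
    PMF.mem_support_uniformOfFinset_iff, argmaxSet, Finset.mem_filter_univ, eq_comm]

theorem sum_eq_of_mem_support_greedyAllocation (hk : k ∈ (greedyAllocation μ s).support) :
    ∑ i, k i = s := by
  induction s generalizing k with
  | zero =>
    obtain rfl : k = fun _ => 0 := by simpa [greedyAllocation] using hk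
    simp
  | succ s ih =>
    obtain ⟨k', hk', i, -, rfl⟩ := mem_support_greedyAllocation_succ.1 hk
    simp [Finset.sum_add_distrib, ih hk']

theorem isGreedy_of_mem_support_greedyAllocation (h0 : ∀ i, 0 ≤ μ i) (h1 : ∀ i, μ i ≤ 1)
    (hk : k ∈ (greedyAllocation μ s).support) : IsGreedy μ k := by
  induction s generalizing k with
  | zero =>
    obtain rfl : k = fun _ => 0 := by simpa [greedyAllocation] using hk
    exact fun i j h => (lt_irrefl 0 h).elim
  | succ s ih =>
    obtain ⟨k', hk', i, hi, rfl⟩ := mem_support_greedyAllocation_succ.1 hk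
    exact (ih hk').add_single h0 h1 hi

end GreedyAllocation

open scoped BigOperators

section UniformAverages

theorem expect_prod {ι : Type*} [Fintype ι] [DecidableEq ι] {β : ι → Type*} [∀ i, Fintype (β i)]
    (F : ∀ i, β i → ℝ) :
    𝔼 φ : ∀ i, β i, ∏ i, F i (φ i) = ∏ i, 𝔼 b, F i b := by
  simp only [Fintype.expect_eq_sum_div_card, Finset.prod_div_distrib, Finset.prod_univ_sum,
    Fintype.piFinset_univ, Fintype.card_pi, Nat.cast_prod]

theorem expect_eval {ι : Type*} [Fintype ι] [DecidableEq ι] {β : ι → Type*} [∀ i, Fintype (β i)]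
    [∀ i, Nonempty (β i)] (i : ι) (G : β i → ℝ) :
    𝔼 φ : ∀ j, β j, G (φ i) = 𝔼 b, G b := by
  let F : ∀ j, β j → ℝ := fun j b => if h : j = i then G (h ▸ b) else 1
  have hF : ∀ j ≠ i, F j = 1 := fun j hj => funext fun b => dif_neg hj
  have hprod := expect_prod F
  have hleft : ∀ φ : ∀ j, β j, ∏ j, F j (φ j) = G (φ i) := fun φ => by
    rw [Fintype.prod_eq_single i fun j hj => by simp [hF j hj]]
    simp [F]
  have hright : ∏ j, 𝔼 b, F j b = 𝔼 b, G b := by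
    rw [Fintype.prod_eq_single i fun j hj => by simp [hF j hj]]
    simp [F]
  simpa only [hleft, hright] using hprod

theorem cast_card_image_eq_sum {κ α : Type*} [Fintype α] [DecidableEq α] (S : Finset κ)
    (ψ : κ → α) : ((S.image ψ).card : ℝ) = ∑ x, (1 - ∏ τ ∈ S, if ψ τ = x then 0 else 1) := by
  have hprod : ∀ x, (1 - ∏ τ ∈ S, if ψ τ = x then (0 : ℝ) else 1) =
      if x ∈ S.image ψ then 1 else 0 := fun x => by
    split_ifs with hx
    · obtain ⟨τ, hτ, hψ⟩ := Finset.mem_image.1 hx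
      have hzero : ∏ τ ∈ S, (if ψ τ = x then (0 : ℝ) else 1) = 0 :=
        Finset.prod_eq_zero hτ (by simp [hψ])
      rw [hzero, sub_zero]
    · rw [Finset.prod_eq_one fun τ hτ => if_neg fun h => hx (Finset.mem_image.2 ⟨τ, hτ, h⟩),
        sub_self]
  simp only [hprod, Finset.sum_ite_mem, Finset.univ_inter, Finset.card_eq_sum_ones, Nat.cast_sum,
    Nat.cast_one]

variable {κ α : Type*} [Fintype κ] [Fintype α] [DecidableEq α] [Nonempty α]

theorem expect_ite_eq (x : α) (c : ℝ) :
    𝔼 b, (if b = x then c else 1) = 1 - 1 / Fintype.card α + 1 / Fintype.card α * c := by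
  have hite : ∀ b : α, (if b = x then c else 1) = 1 + if b = x then c - 1 else 0 := fun b => by
    split_ifs <;> ring
  simp only [Fintype.expect_eq_sum_div_card, hite, Finset.sum_add_distrib, Finset.sum_const,
    Finset.card_univ, nsmul_eq_mul, Finset.sum_ite_eq', Finset.mem_univ, if_true]
  field_simp
  ring

theorem expect_prod_ite_eq [DecidableEq κ] (S : Finset κ) (x : α) (c : ℝ) :
    𝔼 ψ : κ → α, ∏ τ ∈ S, (if ψ τ = x then c else 1) =
      (1 - 1 / Fintype.card α + 1 / Fintype.card α * c) ^ S.card := by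
  have hS : ∀ ψ : κ → α, ∏ τ ∈ S, (if ψ τ = x then c else 1) =
      ∏ τ, if τ ∈ S then (if ψ τ = x then c else 1) else 1 := fun ψ => by simp
  have hfactor : ∀ τ, 𝔼 b, (if τ ∈ S then (if b = x then c else 1) else 1) =
      if τ ∈ S then 1 - 1 / Fintype.card α + 1 / Fintype.card α * c else 1 := fun τ => by
    split_ifs
    · exact expect_ite_eq x c
    · simp
  simp_rw [hS, expect_prod fun τ b => if τ ∈ S then (if b = x then c else 1) else 1, hfactor]
  simp

theorem expect_card_image [DecidableEq κ] (S : Finset κ) :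
    𝔼 ψ : κ → α, ((S.image ψ).card : ℝ) = geomReward (1 / Fintype.card α) S.card := by
  have hgeom := geom_sum_mul (1 - 1 / (Fintype.card α : ℝ)) S.card
  have hcard : (Fintype.card α : ℝ) ≠ 0 := Nat.cast_ne_zero.2 Fintype.card_ne_zero
  simp only [cast_card_image_eq_sum]
  rw [Finset.expect_sum_comm]
  simp only [Finset.expect_sub_distrib, expect_prod_ite_eq, Fintype.expect_const, mul_zero,
    add_zero, Finset.sum_const, Finset.card_univ, nsmul_eq_mul, geomReward]
  field_simp at hgeom ⊢
  linarith

end UniformAverages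

section Realization

variable {m : ℕ} (d : Fin m → ℕ+) {K : ℕ}

/-- The probability `μ_i` that two uniformly random members of community `i` coincide. -/
noncomputable def collisionProb (i : Fin m) : ℝ := 1 / ((d i : ℕ) : ℝ)

theorem collisionProb_pos (i : Fin m) : 0 < collisionProb d i :=
  one_div_pos.2 (Nat.cast_pos.2 (d i).pos)

theorem collisionProb_le_one (i : Fin m) : collisionProb d i ≤ 1 :=
  (div_le_one (Nat.cast_pos.2 (d i).pos)).2 (Nat.one_le_cast.2 (d i).pos)

theorem finite_support_realizationLaw (K : ℕ) : (realizationLaw d K).support.Finite :=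
  Set.toFinite _

theorem expectation_realizationLaw_eval (i : Fin m) (G : (Fin K → Fin (d i : ℕ)) → ℝ) :
    expectation (realizationLaw d K) (fun φ => G (φ i)) = 𝔼 ψ, G ψ := by
  rw [realizationLaw, expectation_uniformOfFintype]
  exact expect_eval (β := fun i => Fin K → Fin (d i : ℕ)) i G

theorem expectedReward_eq {k : Fin m → ℕ} (hk : ∑ i, k i ≤ K) :
    expectedReward d K k = ∑ i, geomReward (collisionProb d i) (k i) := by
  have hle : ∀ i, k i ≤ K := fun i =>
    (Finset.single_le_sum (fun j _ => Nat.zero_le (k j)) (Finset.mem_univ i)).trans hk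
  simp only [expectedReward, reward, Nat.cast_sum]
  rw [expectation_sum (finite_support_realizationLaw d K)]
  refine Finset.sum_congr rfl fun i _ => ?_
  rw [expectation_realizationLaw_eval d i
    fun ψ => (((Finset.univ.filter fun τ : Fin K => (τ : ℕ) < k i).image ψ).card : ℝ),
    expect_card_image, Fin.card_filter_val_lt, min_eq_right (hle i), Fintype.card_fin]
  rfl

end Realization

section Collisions

variable {K : ℕ}

/-- The index of the first member of the pair whose second member has index `τ`. -/
def prevIndex (τ : Fin K) : Fin K := ⟨τ - 1, by omega⟩

theorem not_odd_prevIndex {τ : Fin K} (h : Odd (τ : ℕ)) : ¬ Odd (prevIndex τ : ℕ) := by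
  obtain ⟨j, hj⟩ := h
  exact Nat.not_odd_iff_even.2 ⟨j, by simp only [prevIndex]; omega⟩

/-- The change of variables that replaces the second member of each pair by its difference to
the first one; it turns collisions into independent events. -/
def pairDifference (n K : ℕ) [NeZero n] : (Fin K → Fin n) ≃ (Fin K → Fin n) where
  toFun φ τ := if Odd (τ : ℕ) then φ τ - φ (prevIndex τ) else φ τ
  invFun ψ τ := if Odd (τ : ℕ) then ψ τ + ψ (prevIndex τ) else ψ τ
  left_inv φ := by
    ext1 τ
    by_cases h : Odd (τ : ℕ) <;> simp [h, not_odd_prevIndex]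
  right_inv ψ := by
    ext1 τ
    by_cases h : Odd (τ : ℕ) <;> simp [h, not_odd_prevIndex]

/-- The indices of the second members of the pairs observed in `n` explorations. -/
def secondIndices (K n : ℕ) : Finset (Fin K) :=
  {τ | Odd (τ : ℕ) ∧ (τ : ℕ) < n}

theorem card_secondIndices {n : ℕ} (hn : n ≤ K) : (secondIndices K n).card = n / 2 := by
  let f : Fin (n / 2) → Fin K := fun j => ⟨2 * j + 1, by omega⟩
  have hf : Function.Injective f := fun a b hab => by
    simpa [f, Fin.ext_iff] using hab
  have himage : secondIndices K n = Finset.univ.image f := by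
    ext τ
    simp only [secondIndices, Finset.mem_filter_univ, Finset.mem_image, Finset.mem_univ, true_and,
      Fin.ext_iff, f]
    exact ⟨fun ⟨⟨j, hj⟩, _⟩ => ⟨⟨j, by omega⟩, hj.symm⟩,
      fun ⟨j, hj⟩ => ⟨⟨j, hj.symm⟩, by omega⟩⟩
  rw [himage, Finset.card_image_of_injective _ hf, Finset.card_univ, Fintype.card_fin]

variable {m : ℕ} {d : Fin m → ℕ+}

theorem collisions_eq_card (k : Fin m → ℕ) (φ : Realization d K) (i : Fin m) :
    collisions k φ i =
      ((secondIndices K (k i)).filter fun τ => φ i (prevIndex τ) = φ i τ).card := by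
  rw [collisions, ← Finset.card_image_of_injective _ (f := fun τ : Fin K => (prevIndex τ, τ))
    fun _ _ h => (Prod.ext_iff.1 h).2]
  congr 1
  ext ⟨a, b⟩
  simp only [secondIndices, Finset.mem_filter, Finset.mem_univ, true_and, Finset.mem_image,
    Prod.mk.injEq]
  constructor
  · rintro ⟨heven, hab, hlt, heq⟩
    obtain rfl : prevIndex b = a := Fin.ext (by simp [prevIndex, hab])
    exact ⟨b, ⟨⟨hab ▸ heven.add_one, hlt⟩, heq⟩, rfl, rfl⟩
  · rintro ⟨τ, ⟨⟨⟨j, hj⟩, hlt⟩, heq⟩, rfl, rfl⟩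
    exact ⟨⟨j, by simp only [prevIndex]; omega⟩, by simp only [prevIndex]; omega, hlt, heq⟩

theorem expectation_exp_collisions {k : Fin m → ℕ} {i : Fin m} (hk : k i ≤ K) (l : ℝ) :
    expectation (realizationLaw d K) (fun φ => Real.exp (l * collisions k φ i)) =
      (1 - collisionProb d i + collisionProb d i * Real.exp l) ^ (k i / 2) := by
  have : NeZero (d i : ℕ) := ⟨(d i).pos.ne'⟩
  let F : (Fin K → Fin (d i : ℕ)) → ℝ := fun ψ =>
    ∏ τ ∈ secondIndices K (k i), if ψ τ = 0 then Real.exp l else 1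
  have hexp : ∀ φ : Realization d K,
      Real.exp (l * collisions k φ i) = F (pairDifference (d i : ℕ) K (φ i)) := fun φ => by
    rw [collisions_eq_card, mul_comm, Real.exp_nat_mul, ← Finset.prod_const, Finset.prod_filter]
    refine Finset.prod_congr rfl fun τ hτ => ?_
    have hodd : Odd (τ : ℕ) := (Finset.mem_filter_univ τ |>.1 hτ).1
    simp [pairDifference, hodd, sub_eq_zero, eq_comm]
  simp_rw [hexp]
  rw [expectation_realizationLaw_eval d i fun ψ => F (pairDifference (d i : ℕ) K ψ),
    Fintype.expect_equiv (pairDifference (d i : ℕ) K) _ F fun _ => rfl, expect_prod_ite_eq,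
    card_secondIndices hk, Fintype.card_fin]
  rfl

end Collisions

section Histories

variable {m : ℕ} {d : Fin m → ℕ+} {K : ℕ}

theorem pairCount_nil (i : Fin m) : pairCount ([] : History d K) i = 0 := rfl

theorem pairCount_cons (r : (Fin m → ℕ) × Realization d K) (h : History d K) (i : Fin m) :
    pairCount (r :: h) i = r.1 i / 2 + pairCount h i := rfl

theorem collisionCount_nil (i : Fin m) : collisionCount ([] : History d K) i = 0 := rfl

theorem collisionCount_cons (r : (Fin m → ℕ) × Realization d K) (h : History d K) (i : Fin m) :
    collisionCount (r :: h) i = collisions r.1 r.2 i + collisionCount h i := rfl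

theorem collisions_le (k : Fin m → ℕ) (φ : Realization d K) (i : Fin m) :
    collisions k φ i ≤ k i / 2 := by
  have hmin : secondIndices K (k i) = secondIndices K (min (k i) K) := by
    ext τ
    simp [secondIndices]
  calc collisions k φ i ≤ (secondIndices K (k i)).card := by
        rw [collisions_eq_card]
        exact Finset.card_filter_le _ _
    _ = min (k i) K / 2 := by rw [hmin, card_secondIndices (min_le_right _ _)]
    _ ≤ k i / 2 := Nat.div_le_div_right (min_le_left _ _)

theorem collisionCount_le (h : History d K) (i : Fin m) : collisionCount h i ≤ pairCount h i :=
  List.sum_le_sum fun r _ => collisions_le r.1 r.2 i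

theorem empiricalMean_le_one (h : History d K) (i : Fin m) : empiricalMean h i ≤ 1 := by
  unfold empiricalMean
  split_ifs
  · exact zero_le_one
  · exact div_le_one_of_le₀ (Nat.cast_le.2 (collisionCount_le h i)) (Nat.cast_nonneg _)

theorem confidenceRadius_nonneg (t : ℕ) (h : History d K) (i : Fin m) :
    0 ≤ confidenceRadius t h i := by
  unfold confidenceRadius
  split_ifs
  · exact le_rfl
  · exact Real.sqrt_nonneg _

/-- The lower confidence bounds on which the round after the history `h` is based. -/
noncomputable abbrev nextBound (h : History d K) : Fin m → ℝ :=
  lowerConfidenceBound (h.length + 1) h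

/-- The confidence radii on which the round after the history `h` is based. -/
noncomputable abbrev nextRadius (h : History d K) : Fin m → ℝ :=
  confidenceRadius (h.length + 1) h

theorem nextBound_nonneg (h : History d K) (i : Fin m) : 0 ≤ nextBound h i := le_max_left _ _

theorem nextBound_le_one (h : History d K) (i : Fin m) : nextBound h i ≤ 1 :=
  max_le zero_le_one ((sub_le_self _ (confidenceRadius_nonneg _ h i)).trans
    (empiricalMean_le_one h i))

/-- The algorithm plays the allocation `k` after the history `h` with positive probability. -/
def IsPlayable [NeZero m] (h : History d K) (k : Fin m → ℕ) : Prop :=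
  k ∈ (greedyAllocation (nextBound h) K).support

/-- The histories that the algorithm produces with positive probability. -/
def IsReachable [NeZero m] : History d K → Prop
  | [] => True
  | r :: h => IsPlayable h r.1 ∧ IsReachable h

variable [NeZero m] {h h' : History d K} {k : Fin m → ℕ}

theorem IsPlayable.sum_eq (hk : IsPlayable h k) : ∑ i, k i = K :=
  sum_eq_of_mem_support_greedyAllocation hk

theorem IsPlayable.le (hk : IsPlayable h k) (i : Fin m) : k i ≤ K :=
  hk.sum_eq ▸ Finset.single_le_sum (fun j _ => Nat.zero_le (k j)) (Finset.mem_univ i)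

theorem IsPlayable.isGreedy (hk : IsPlayable h k) : IsGreedy (nextBound h) k :=
  isGreedy_of_mem_support_greedyAllocation (nextBound_nonneg h) (nextBound_le_one h) hk

theorem IsReachable.of_suffix (hh : IsReachable h) (hs : h' <:+ h) : IsReachable h' := by
  induction h with
  | nil => rwa [List.suffix_nil.1 hs]
  | cons r h ih =>
    rcases List.suffix_cons_iff.1 hs with rfl | hs
    · exact hh
    · exact ih hh.2 hs

theorem IsReachable.isPlayable (hh : IsReachable h) {r : (Fin m → ℕ) × Realization d K}
    (hs : r :: h' <:+ h) : IsPlayable h' r.1 :=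
  (hh.of_suffix hs).1

theorem IsReachable.pairCount_le (hh : IsReachable h) (i : Fin m) :
    pairCount h i ≤ K / 2 * h.length := by
  induction h with
  | nil => simp [pairCount_nil]
  | cons r h ih =>
    have hr : r.1 i / 2 ≤ K / 2 := Nat.div_le_div_right (hh.1.le i)
    rw [pairCount_cons, List.length_cons, mul_add, mul_one]
    linarith [ih hh.2]

end Histories

section HistoryLaw

variable {m : ℕ} [NeZero m] (d : Fin m → ℕ+) (K : ℕ)

theorem finite_support_clcbHistory (T : ℕ) : (clcbHistory d K T).support.Finite := by
  induction T with
  | zero => simp [clcbHistory]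
  | succ T ih =>
    exact finite_support_bind ih fun h =>
      finite_support_bind (finite_support_greedyAllocation _ K) fun k =>
        finite_support_map (finite_support_realizationLaw d K) _

variable {d K}

theorem length_and_isReachable_of_mem_support {T : ℕ} {h : History d K}
    (hh : h ∈ (clcbHistory d K T).support) : h.length = T ∧ IsReachable h := by
  induction T generalizing h with
  | zero =>
    obtain rfl : h = [] := by simpa [clcbHistory] using hh
    exact ⟨rfl, trivial⟩
  | succ T ih =>
    simp only [clcbHistory, PMF.mem_support_bind_iff, PMF.mem_support_map_iff] at hh
    obtain ⟨h', hh', k, hk, φ, -, rfl⟩ := hh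
    obtain ⟨rfl, hreach⟩ := ih hh'
    exact ⟨rfl, hk, hreach⟩

/-- The conditional expectation of `F` after the next round, given the history `h`. -/
noncomputable def nextExpectation (F : History d K → ℝ) (h : History d K) : ℝ :=
  expectation (greedyAllocation (nextBound h) K) fun k =>
    expectation (realizationLaw d K) fun φ => F ((k, φ) :: h)

theorem expectation_clcbHistory_succ (T : ℕ) (F : History d K → ℝ) :
    expectation (clcbHistory d K (T + 1)) F =
      expectation (clcbHistory d K T) (nextExpectation F) := by
  have hr := finite_support_realizationLaw d K
  have hg := fun h : History d K =>
    finite_support_greedyAllocation (lowerConfidenceBound (T + 1) h) K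
  rw [clcbHistory, expectation_bind (finite_support_clcbHistory d K T)
    fun h => finite_support_bind (hg h) fun k => finite_support_map hr _]
  refine expectation_congr (finite_support_clcbHistory d K T) fun h hh => ?_
  rw [expectation_bind (hg h) fun k => finite_support_map hr _, nextExpectation, nextBound,
    (length_and_isReachable_of_mem_support hh).1]
  simp only [expectation_map hr]

/-- `F` is a supermartingale along the rounds of the algorithm; the expectation is over the
realization only, for every allocation that may be played. -/
def IsSupermartingale (F : History d K → ℝ) : Prop :=
  ∀ h k, IsPlayable h k → expectation (realizationLaw d K) (fun φ => F ((k, φ) :: h)) ≤ F h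

theorem IsSupermartingale.expectation_le {F : History d K → ℝ} (hF : IsSupermartingale F)
    (T : ℕ) : expectation (clcbHistory d K T) F ≤ F [] := by
  induction T with
  | zero => rw [clcbHistory, expectation_pure]
  | succ T ih =>
    rw [expectation_clcbHistory_succ]
    refine (expectation_mono (finite_support_clcbHistory d K T) fun h _ => ?_).trans ih
    exact (expectation_mono (finite_support_greedyAllocation _ K) (hF h)).trans_eq
      (expectation_const (finite_support_greedyAllocation _ K) _)

end HistoryLaw

section Stopping

open Classical in
/-- The process `F`, stopped when it reaches the level `a`. -/
noncomputable def stopAt {α : Type*} (a : ℝ) (F : List α → ℝ) : List α → ℝ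
  | [] => F []
  | r :: h => if a ≤ stopAt a F h then stopAt a F h else F (r :: h)

variable {α : Type*} {a : ℝ} {F : List α → ℝ} {h h' : List α}

theorem stopAt_cons_of_le (r : α) (hle : a ≤ stopAt a F h) :
    stopAt a F (r :: h) = stopAt a F h :=
  if_pos hle

theorem stopAt_cons_of_lt (r : α) (hlt : stopAt a F h < a) :
    stopAt a F (r :: h) = F (r :: h) :=
  if_neg hlt.not_ge

theorem stopAt_eq_of_lt (hlt : stopAt a F h < a) : stopAt a F h = F h := by
  cases h with
  | nil => rfl
  | cons r h =>
    rcases le_or_gt a (stopAt a F h) with hle | hgt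
    · exact absurd (stopAt_cons_of_le r hle ▸ hlt) hle.not_gt
    · exact stopAt_cons_of_lt r hgt

theorem le_stopAt (hs : h' <:+ h) (ha : a ≤ F h') : a ≤ stopAt a F h := by
  induction h with
  | nil => rwa [List.suffix_nil.1 hs] at ha
  | cons r h ih =>
    rcases le_or_gt a (stopAt a F h) with hle | hgt
    · rwa [stopAt_cons_of_le r hle]
    · rcases List.suffix_cons_iff.1 hs with rfl | hs
      · rwa [stopAt_cons_of_lt r hgt]
      · exact absurd (ih hs) hgt.not_ge

theorem stopAt_nonneg (hF : ∀ h, 0 ≤ F h) (h : List α) : 0 ≤ stopAt a F h := by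
  induction h with
  | nil => exact hF []
  | cons r h ih =>
    unfold stopAt
    split_ifs
    · exact ih
    · exact hF _

variable {m : ℕ} [NeZero m] {d : Fin m → ℕ+} {K : ℕ} {F : History d K → ℝ}

theorem IsSupermartingale.stopAt (hF : IsSupermartingale F) (a : ℝ) :
    IsSupermartingale (stopAt a F) := by
  intro h k hk
  rcases le_or_gt a (CommunityExploration.stopAt a F h) with hle | hgt
  · simp only [stopAt_cons_of_le _ hle]
    rw [expectation_const (finite_support_realizationLaw d K)]
  · simp only [stopAt_cons_of_lt _ hgt, stopAt_eq_of_lt hgt]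
    exact hF h k hk

theorem IsSupermartingale.mul_probability_exists_suffix_le (hF : IsSupermartingale F)
    (h0 : ∀ h, 0 ≤ F h) (a : ℝ) (T : ℕ) :
    a * probability (clcbHistory d K T) {h | ∃ h', h' <:+ h ∧ a ≤ F h'} ≤ F [] := by
  rw [probability, ← expectation_const_mul]
  refine (expectation_mono (finite_support_clcbHistory d K T) fun h _ => ?_).trans
    ((hF.stopAt a).expectation_le T)
  by_cases hex : ∃ h', h' <:+ h ∧ a ≤ F h'
  · obtain ⟨h', hs, ha⟩ := id hex
    simpa [hex] using le_stopAt hs ha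
  · simpa [hex] using stopAt_nonneg h0 h

end Stopping

section Concentration

open MeasureTheory ProbabilityTheory in
theorem one_sub_add_mul_exp_le {p : ℝ} (h0 : 0 ≤ p) (h1 : p ≤ 1) (l : ℝ) :
    1 - p + p * Real.exp l ≤ Real.exp (l * p + l ^ 2 / 8) := by
  let ν : Measure ℝ := bernoulliMeasure 1 0 ⟨p, h0, h1⟩
  have hmean : ∫ x, x ∂ν = p := by simp [ν, integral_bernoulliMeasure]
  have hmem : ∀ᵐ x ∂ν, x ∈ Set.Icc (0 : ℝ) 1 := by
    rw [ae_iff]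
    exact bernoulliMeasure_apply_of_notMem_of_notMem _ measurableSet_Icc.compl (by simp) (by simp)
  have hmgf := (hasSubgaussianMGF_of_mem_Icc aemeasurable_id hmem).mgf_le l
  simp only [mgf, id_eq, hmean, ν, integral_bernoulliMeasure, smul_eq_mul] at hmgf
  have hshift : ∀ x : ℝ, Real.exp (l * x) = Real.exp (l * p) * Real.exp (l * (x - p)) := fun x => by
    rw [← Real.exp_add]
    ring_nf
  calc 1 - p + p * Real.exp l
      = Real.exp (l * p) *
          (p * Real.exp (l * (1 - p)) + (1 - p) * Real.exp (l * (0 - p))) := by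
        have hzero := hshift 0
        have hone := hshift 1
        rw [mul_zero, Real.exp_zero] at hzero
        rw [mul_one] at hone
        linear_combination p * hone + (1 - p) * hzero
    _ ≤ Real.exp (l * p) * Real.exp (l ^ 2 / 8) := by
        gcongr
        refine hmgf.trans_eq ?_
        congr 1
        norm_num
        ring
    _ = Real.exp (l * p + l ^ 2 / 8) := (Real.exp_add _ _).symm

variable {m : ℕ} {d : Fin m → ℕ+} {K : ℕ}

variable (d K) in
/-- The exponential supermartingale with parameter `l` of the collisions in community `i`. -/
noncomputable def expDeviation (i : Fin m) (l : ℝ) (h : History d K) : ℝ :=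
  Real.exp (l * collisionCount h i - (l * collisionProb d i + l ^ 2 / 8) * pairCount h i)

theorem expDeviation_nil (i : Fin m) (l : ℝ) : expDeviation d K i l [] = 1 := by
  simp [expDeviation, collisionCount_nil, pairCount_nil]

theorem expDeviation_cons (i : Fin m) (l : ℝ) (k : Fin m → ℕ) (φ : Realization d K)
    (h : History d K) :
    expDeviation d K i l ((k, φ) :: h) =
      expDeviation d K i l h * Real.exp (-((k i / 2 : ℕ) * (l * collisionProb d i + l ^ 2 / 8))) *
        Real.exp (l * collisions k φ i) := by
  simp only [expDeviation, collisionCount_cons, pairCount_cons, ← Real.exp_add]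
  push_cast
  ring_nf

variable (d K) in
theorem isSupermartingale_expDeviation [NeZero m] (i : Fin m) (l : ℝ) :
    IsSupermartingale (expDeviation d K i l) := by
  intro h k hk
  have h0 := (collisionProb_pos d i).le
  have h1 := collisionProb_le_one d i
  simp only [expDeviation_cons]
  rw [expectation_const_mul, expectation_exp_collisions (hk.le i), mul_assoc]
  refine mul_le_of_le_one_right (Real.exp_pos _).le ?_
  rw [Real.exp_neg, inv_mul_le_one₀ (Real.exp_pos _), Real.exp_nat_mul]
  have hbase : 0 ≤ 1 - collisionProb d i + collisionProb d i * Real.exp l :=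
    add_nonneg (sub_nonneg.2 h1) (mul_nonneg h0 (Real.exp_pos l).le)
  exact pow_le_pow_left₀ hbase (one_sub_add_mul_exp_le h0 h1 l) _

theorem exp_le_expDeviation {h : History d K} {i : Fin m} {r s : ℝ} (hr : 0 ≤ r)
    (hs : s ^ 2 = 1) (hp : pairCount h i ≠ 0)
    (hdev : r ≤ s * (empiricalMean h i - collisionProb d i)) :
    Real.exp (2 * r ^ 2 * pairCount h i) ≤ expDeviation d K i (s * (4 * r)) h := by
  have hpos : (0 : ℝ) < pairCount h i := Nat.cast_pos.2 (Nat.pos_of_ne_zero hp)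
  rw [empiricalMean, if_neg hp] at hdev
  have hscaled : r * pairCount h i ≤
      s * (collisionCount h i - collisionProb d i * pairCount h i) := by
    calc r * pairCount h i
        ≤ s * (collisionCount h i / pairCount h i - collisionProb d i) * pairCount h i := by gcongr
      _ = s * (collisionCount h i - collisionProb d i * pairCount h i) := by field_simp
  refine Real.exp_le_exp.2 ?_
  calc 2 * r ^ 2 * pairCount h i
      = 4 * r * (r * pairCount h i) - 2 * r ^ 2 * pairCount h i := by ring
    _ ≤ 4 * r * (s * (collisionCount h i - collisionProb d i * pairCount h i)) -
          2 * r ^ 2 * pairCount h i := by gcongr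
    _ = s * (4 * r) * collisionCount h i -
          (s * (4 * r) * collisionProb d i + (s * (4 * r)) ^ 2 / 8) * pairCount h i := by
        linear_combination 2 * r ^ 2 * pairCount h i * hs

variable [NeZero m]

theorem probability_exists_deviation_le (i : Fin m) {r w : ℝ} (hr : 0 ≤ r) (hw : 0 < w) (T : ℕ) :
    probability (clcbHistory d K T)
        {h | ∃ h', h' <:+ h ∧ w ≤ pairCount h' i ∧ r ≤ |empiricalMean h' i - collisionProb d i|} ≤
      2 * Real.exp (-(2 * r ^ 2 * w)) := by
  let crossing : ℝ → Set (History d K) := fun s =>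
    {h | ∃ h', h' <:+ h ∧ Real.exp (2 * r ^ 2 * w) ≤ expDeviation d K i (s * (4 * r)) h'}
  have hcrossing : ∀ s, probability (clcbHistory d K T) (crossing s) ≤
      Real.exp (-(2 * r ^ 2 * w)) := fun s => by
    have hmart := isSupermartingale_expDeviation d K i (s * (4 * r))
    have hville := hmart.mul_probability_exists_suffix_le (fun _ => (Real.exp_pos _).le)
      (Real.exp (2 * r ^ 2 * w)) T
    rw [expDeviation_nil] at hville
    rwa [Real.exp_neg, ← one_div, le_div_iff₀' (Real.exp_pos _)]
  calc probability (clcbHistory d K T) _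
      ≤ ∑ s ∈ {1, -1}, probability (clcbHistory d K T) (crossing s) := by
        refine probability_le_sum (finite_support_clcbHistory d K T) fun h _ hh => ?_
        obtain ⟨h', hs, hcount, hdev⟩ := hh
        have hp : pairCount h' i ≠ 0 := fun hzero => by
          rw [hzero, Nat.cast_zero] at hcount
          exact hw.not_ge hcount
        have hexp : Real.exp (2 * r ^ 2 * w) ≤ Real.exp (2 * r ^ 2 * pairCount h' i) := by gcongr
        rcases le_abs.1 hdev with hdev | hdev
        · exact ⟨1, by simp, h', hs, hexp.trans
            (exp_le_expDeviation hr (one_pow 2) hp (by linarith))⟩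
        · exact ⟨-1, by simp, h', hs, hexp.trans
            (exp_le_expDeviation hr (by norm_num) hp (by linarith))⟩
    _ ≤ ∑ s ∈ ({1, -1} : Finset ℝ), Real.exp (-(2 * r ^ 2 * w)) :=
        Finset.sum_le_sum fun s _ => hcrossing s
    _ = 2 * Real.exp (-(2 * r ^ 2 * w)) := by
        rw [Finset.sum_const, Finset.card_pair (by norm_num), nsmul_eq_mul, Nat.cast_ofNat]

variable (d K) in
/-- The histories after which all the empirical means respect their confidence intervals. -/
def goodHistories : Set (History d K) :=
  {h | ∀ i, pairCount h i ≠ 0 →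
    |empiricalMean h i - collisionProb d i| ≤ nextRadius h i}

theorem exp_neg_sqrt_log_div_sq (n : ℕ) {s : ℕ} (hs : s ≠ 0) :
    Real.exp (-(2 * √(3 * Real.log (n + 1 : ℕ) / (2 * s)) ^ 2 * s)) = ((n + 1 : ℝ) ^ 3)⁻¹ := by
  have : 0 ≤ Real.log (n + 1 : ℕ) := Real.log_natCast_nonneg _
  have hexponent : 2 * √(3 * Real.log (n + 1 : ℕ) / (2 * s)) ^ 2 * s =
      (3 : ℕ) * Real.log (n + 1 : ℕ) := by
    rw [Real.sq_sqrt (by positivity)]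
    push_cast
    field_simp
  rw [hexponent, Real.exp_neg, Real.exp_nat_mul, Real.exp_log (by positivity), Nat.cast_succ]

variable (d K) in
theorem probability_compl_goodHistories_le (n : ℕ) :
    probability (clcbHistory d K n) (goodHistories d K)ᶜ ≤
      2 * m * (K / 2 : ℕ) / (n + 1 : ℝ) ^ 2 := by
  let radius : ℕ → ℝ := fun s => √(3 * Real.log (n + 1 : ℕ) / (2 * s))
  let deviating : Fin m × ℕ → Set (History d K) := fun a => {h | ∃ h', h' <:+ h ∧
    (a.2 : ℝ) ≤ pairCount h' a.1 ∧ radius a.2 ≤ |empiricalMean h' a.1 - collisionProb d a.1|}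
  calc probability (clcbHistory d K n) (goodHistories d K)ᶜ
      ≤ ∑ a ∈ Finset.univ ×ˢ Finset.Icc 1 (K / 2 * n),
          probability (clcbHistory d K n) (deviating a) := by
        refine probability_le_sum (finite_support_clcbHistory d K n) fun h hh hbad => ?_
        obtain ⟨rfl, hreach⟩ := length_and_isReachable_of_mem_support hh
        simp only [goodHistories, Set.mem_compl_iff, Set.mem_ofPred_eq, not_forall, not_le] at hbad
        obtain ⟨i, hp, hdev⟩ := hbad
        rw [nextRadius, confidenceRadius, if_neg hp] at hdev
        have hmem := Finset.mem_Icc.2 ⟨Nat.one_le_iff_ne_zero.2 hp, hreach.pairCount_le i⟩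
        exact ⟨(i, pairCount h i), Finset.mk_mem_product (Finset.mem_univ i) hmem,
          h, List.suffix_rfl, le_rfl, hdev.le⟩
    _ ≤ ∑ a ∈ (Finset.univ : Finset (Fin m)) ×ˢ Finset.Icc 1 (K / 2 * n),
          2 * ((n + 1 : ℝ) ^ 3)⁻¹ := by
        refine Finset.sum_le_sum fun a ha => ?_
        have hs : a.2 ≠ 0 := Nat.one_le_iff_ne_zero.1
          (Finset.mem_Icc.1 (Finset.mem_product.1 ha).2).1
        rw [← exp_neg_sqrt_log_div_sq n hs]
        exact probability_exists_deviation_le a.1 (Real.sqrt_nonneg _)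
          (Nat.cast_pos.2 (Nat.pos_of_ne_zero hs)) n
    _ = 2 * m * (K / 2 : ℕ) / (n + 1 : ℝ) ^ 2 * (n / (n + 1 : ℝ)) := by
        rw [Finset.sum_const, Finset.card_product, Finset.card_univ, Fintype.card_fin,
          Nat.card_Icc, add_tsub_cancel_right, nsmul_eq_mul]
        push_cast
        field_simp
    _ ≤ 2 * m * (K / 2 : ℕ) / (n + 1 : ℝ) ^ 2 :=
        mul_le_of_le_one_right (by positivity) (div_le_one_of_le₀ (by linarith) (by positivity))

end Concentration

section Gaps

variable {m : ℕ} {d : Fin m → ℕ+} {K : ℕ} {kstar k : Fin m → ℕ} {i j : Fin m}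

theorem gap_nonneg (hopt : IsOptimalAllocation d K kstar) (hk : ∑ i, k i = K) :
    0 ≤ gap d K kstar k :=
  sub_nonneg.2 (hopt.2 k hk.le)

variable (d K) in
theorem exists_isGreedy [NeZero m] :
    ∃ k : Fin m → ℕ, ∑ i, k i = K ∧ IsGreedy (collisionProb d) k := by
  obtain ⟨k, hk⟩ := (greedyAllocation (collisionProb d) K).support_nonempty
  exact ⟨k, sum_eq_of_mem_support_greedyAllocation hk, isGreedy_of_mem_support_greedyAllocation
    (fun i => (collisionProb_pos d i).le) (collisionProb_le_one d) hk⟩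

theorem gap_eq_zero_of_isGreedy [NeZero m] (hopt : IsOptimalAllocation d K kstar)
    (hk : ∑ i, k i = K) (hg : IsGreedy (collisionProb d) k) : gap d K kstar k = 0 := by
  refine le_antisymm ?_ (gap_nonneg hopt hk)
  rw [gap, sub_nonpos, expectedReward_eq d hopt.1, expectedReward_eq d hk.le]
  exact hg.sum_geomReward_le (fun i => (collisionProb_pos d i).le) (collisionProb_le_one d)
    (hopt.1.trans hk.ge)

theorem gap_eq_zero_of_subsingleton [NeZero m] [Subsingleton (Fin m)]
    (hopt : IsOptimalAllocation d K kstar) (hk : ∑ i, k i = K) : gap d K kstar k = 0 := by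
  obtain ⟨k', hk', hg⟩ := exists_isGreedy d K
  obtain rfl : k = k' := by
    funext i
    rw [Fintype.sum_subsingleton _ i] at hk hk'
    rw [hk, hk']
  exact gap_eq_zero_of_isGreedy hopt hk hg

variable (d K kstar i) in
theorem finite_badActions : (badActions d K kstar i).Finite := by
  refine (Set.finite_Iic fun _ : Fin m => K).subset fun k hk j => ?_
  exact hk.1 ▸ Finset.single_le_sum (fun l _ => Nat.zero_le (k l)) (Finset.mem_univ j)

theorem gapMax_nonneg : 0 ≤ gapMax d K kstar := by
  refine Real.iSup_nonneg fun i => Real.sSup_nonneg ?_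
  rintro _ ⟨k, hk, rfl⟩
  exact hk.2.1.le

theorem gap_le_gapMax (hm : m < K) (hk : ∑ i, k i = K) : gap d K kstar k ≤ gapMax d K kstar := by
  rcases le_or_gt (gap d K kstar k) 0 with hle | hpos
  · exact hle.trans gapMax_nonneg
  · obtain ⟨i, hi⟩ := exists_one_lt_of_card_lt_sum (k := k) (by simpa [hk] using hm)
    calc gap d K kstar k ≤ gapMaxAt d K kstar i :=
          le_csSup ((finite_badActions d K kstar i).image _).bddAbove
            (Set.mem_image_of_mem _ ⟨hk, hpos, hi⟩)
      _ ≤ gapMax d K kstar :=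
          le_ciSup (f := gapMaxAt d K kstar) (Set.finite_range _).bddAbove i

theorem invGapMin_nonneg (i : Fin m) : 0 ≤ invGapMin d K kstar i := ENNReal.toReal_nonneg

theorem inv_gap_le_invGapMin (hk : k ∈ badActions d K kstar i) :
    (gap d K kstar k)⁻¹ ≤ invGapMin d K kstar i := by
  have hle : gapMin d K kstar i ≤ ENNReal.ofReal (gap d K kstar k) :=
    sInf_le (Set.mem_image_of_mem _ hk)
  have hne : gapMin d K kstar i ≠ 0 := by
    obtain ⟨k', hk', hmin⟩ := Set.Nonempty.csInf_mem
      ⟨_, Set.mem_image_of_mem (fun k => ENNReal.ofReal (gap d K kstar k)) hk⟩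
      ((finite_badActions d K kstar i).image _)
    rw [gapMin, ← hmin]
    exact (ENNReal.ofReal_pos.2 hk'.2.1).ne'
  rw [invGapMin, ← ENNReal.toReal_ofReal hk.2.1.le, ← ENNReal.toReal_inv]
  exact ENNReal.toReal_mono (ENNReal.inv_ne_top.2 hne) (ENNReal.inv_le_inv.2 hle)

end Gaps

section Transfer

variable {ι : Type*} [DecidableEq ι]

/-- The allocation that results from `k` when `b` units are moved from `j` to `i`; it is used for
`b ≤ k j`. -/
def transfer (k : ι → ℕ) (i j : ι) (b : ℕ) : ι → ℕ :=
  Function.update (Function.update k i (k i + b)) j (k j - b)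

variable {i j : ι}

theorem transfer_zero (k : ι → ℕ) (i j : ι) : transfer k i j 0 = k := by simp [transfer]

theorem transfer_apply_left (k : ι → ℕ) (hij : i ≠ j) (b : ℕ) :
    transfer k i j b i = k i + b := by
  simp [transfer, hij]

theorem sum_apply_transfer [Fintype ι] {M : Type*} [AddCommGroup M] (f : ι → ℕ → M) (k : ι → ℕ)
    (hij : i ≠ j) (b : ℕ) :
    ∑ l, f l (transfer k i j b l) =
      ∑ l, f l (k l) + (f i (k i + b) - f i (k i)) + (f j (k j - b) - f j (k j)) := by
  have hupdate : ∀ (k : ι → ℕ) i a,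
      ∑ l, f l (Function.update k i a l) = ∑ l, f l (k l) + (f i a - f i (k i)) := by
    intro k i a
    rw [← sub_eq_iff_eq_add', ← Finset.sum_sub_distrib, Fintype.sum_eq_single i fun l hl => by
      rw [Function.update_of_ne hl, sub_self], Function.update_self]
  rw [transfer, hupdate, hupdate, Function.update_of_ne hij.symm]

theorem sum_transfer [Fintype ι] (k : ι → ℕ) (hij : i ≠ j) {b : ℕ} (hb : b ≤ k j) :
    ∑ l, transfer k i j b l = ∑ l, k l := by
  have hsum := sum_apply_transfer (fun _ n => (n : ℤ)) k hij b
  push_cast [Nat.cast_sub hb] at hsum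
  zify
  linarith

end Transfer

section SmallGap

theorem exists_lt_nonpos_and_pos_succ {f : ℕ → ℝ} {n : ℕ} (h0 : f 0 ≤ 0) (hn : 0 < f n) :
    ∃ c < n, f c ≤ 0 ∧ 0 < f (c + 1) := by
  induction n with
  | zero => exact absurd hn h0.not_gt
  | succ n ih =>
    rcases le_or_gt (f n) 0 with hle | hgt
    · exact ⟨n, n.lt_succ_self, hle, hn⟩
    · obtain ⟨c, hc, hf⟩ := ih hgt
      exact ⟨c, hc.trans n.lt_succ_self, hf⟩

variable {m : ℕ} {d : Fin m → ℕ+} {K : ℕ} {kstar k : Fin m → ℕ} {i j : Fin m}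

theorem gap_transfer_succ_sub_gap_transfer (hk : ∑ l, k l = K) (hij : i ≠ j) {b : ℕ}
    (hb : b < k j) :
    gap d K kstar (transfer k i j (b + 1)) - gap d K kstar (transfer k i j b) =
      (1 - collisionProb d j) ^ (k j - (b + 1)) - (1 - collisionProb d i) ^ (k i + b) := by
  have hsum : ∀ c ≤ k j, ∑ l, transfer k i j c l ≤ K := fun c hc =>
    ((sum_transfer k hij hc).trans hk).le
  have hsucc : k j - b = k j - (b + 1) + 1 := by omega
  rw [gap, gap, expectedReward_eq d (hsum b hb.le), expectedReward_eq d (hsum (b + 1) hb),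
    sum_apply_transfer _ k hij, sum_apply_transfer _ k hij, hsucc, geomReward_succ, ← add_assoc,
    geomReward_succ]
  ring

theorem gap_transfer_succ_le (hk : ∑ l, k l = K) (hij : i ≠ j) {b : ℕ} (hb : b < k j) :
    gap d K kstar (transfer k i j (b + 1)) ≤
      gap d K kstar (transfer k i j b) + (k i + b : ℕ) * collisionProb d i := by
  have hj : (1 - collisionProb d j) ^ (k j - (b + 1)) ≤ 1 :=
    pow_le_one₀ (sub_nonneg.2 (collisionProb_le_one d j))
      (sub_le_self 1 (collisionProb_pos d j).le)
  have hbernoulli := one_add_mul_le_pow (a := -collisionProb d i)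
    (by linarith [collisionProb_le_one d i]) (k i + b)
  rw [← sub_eq_add_neg] at hbernoulli
  linarith [gap_transfer_succ_sub_gap_transfer (d := d) (kstar := kstar) hk hij hb]

theorem gap_transfer_self_pos (hopt : IsOptimalAllocation d K kstar) (hk : ∑ l, k l = K)
    (hij : i ≠ j) (hi : 0 < k i) (hj : 0 < k j) : 0 < gap d K kstar (transfer k i j (k j)) := by
  have hlast := gap_transfer_succ_sub_gap_transfer (d := d) (kstar := kstar) (b := k j - 1)
    hk hij (by omega)
  rw [Nat.sub_add_cancel hj, Nat.sub_self, pow_zero] at hlast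
  have hprev := gap_nonneg hopt ((sum_transfer k hij (k j).pred_le).trans hk)
  have hlt : (1 - collisionProb d i) ^ (k i + (k j - 1)) < 1 :=
    pow_lt_one₀ (sub_nonneg.2 (collisionProb_le_one d i)) (sub_lt_self 1 (collisionProb_pos d i))
      (by omega)
  rw [Nat.pred_eq_sub_one] at hprev
  linarith

variable [NeZero m]

theorem exists_mem_badActions_gap_le (hopt : IsOptimalAllocation d K kstar) (hm : m < K)
    (hij : i ≠ j) :
    ∃ k ∈ badActions d K kstar i, gap d K kstar k ≤ (K - m + 1 : ℕ) * collisionProb d i := by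
  obtain ⟨k, hk, hg⟩ := exists_isGreedy d K
  have hpos := hg.one_le (collisionProb_pos d) (collisionProb_le_one d) (by simpa [hk] using hm.le)
  obtain ⟨c, hc, hzero, hgap⟩ := exists_lt_nonpos_and_pos_succ
    (f := fun b => gap d K kstar (transfer k i j b))
    (by simp only [transfer_zero, gap_eq_zero_of_isGreedy hopt hk hg, le_refl])
    (gap_transfer_self_pos hopt hk hij (hpos i) (hpos j))
  have hcount : k i + c ≤ K - m + 1 := by
    have hone : ∀ l, 1 ≤ transfer k i j c l := fun l => by
      rcases eq_or_ne l j with rfl | hlj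
      · simp only [transfer, Function.update_self]
        omega
      · rcases eq_or_ne l i with rfl | hli
        · simp only [transfer_apply_left k hij]
          exact (hpos l).trans (Nat.le_add_right _ _)
        · simpa [transfer, hlj, hli] using hpos l
    have hcard := add_card_le_sum_add_one hone i
    rw [sum_transfer k hij hc.le, hk, transfer_apply_left k hij, Fintype.card_fin] at hcard
    omega
  refine ⟨transfer k i j (c + 1), ⟨(sum_transfer k hij hc).trans hk, hgap, ?_⟩, ?_⟩
  · have hi := hpos i
    rw [transfer_apply_left k hij]
    omega
  · calc gap d K kstar (transfer k i j (c + 1))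
        ≤ gap d K kstar (transfer k i j c) + (k i + c : ℕ) * collisionProb d i :=
          gap_transfer_succ_le hk hij hc
      _ ≤ 0 + (K - m + 1 : ℕ) * collisionProb d i := by
          have hμ := (collisionProb_pos d i).le
          gcongr
      _ = (K - m + 1 : ℕ) * collisionProb d i := zero_add _

theorem inv_mul_collisionProb_le_invGapMin (hopt : IsOptimalAllocation d K kstar) (hm : m < K)
    (hij : i ≠ j) : ((K - m + 1 : ℕ) * collisionProb d i)⁻¹ ≤ invGapMin d K kstar i := by
  obtain ⟨k, hk, hle⟩ := exists_mem_badActions_gap_le hopt hm hij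
  exact (inv_anti₀ hk.2.1 hle).trans (inv_gap_le_invGapMin hk)

end SmallGap

section PathSums

variable {α : Type*} {c c' : α → List α → ℝ} {h : List α}

/-- The sum over the entries of a history of a cost that depends on the entry and on the part of
the history before it. -/
noncomputable def pathSum (c : α → List α → ℝ) : List α → ℝ
  | [] => 0
  | r :: h => c r h + pathSum c h

theorem pathSum_add (c c' : α → List α → ℝ) (h : List α) :
    pathSum (fun r h => c r h + c' r h) h = pathSum c h + pathSum c' h := by
  induction h with
  | nil => exact (add_zero 0).symm
  | cons r h ih => simp only [pathSum, ih, add_add_add_comm]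

theorem pathSum_const_mul (a : ℝ) (c : α → List α → ℝ) (h : List α) :
    pathSum (fun r h => a * c r h) h = a * pathSum c h := by
  induction h with
  | nil => exact (mul_zero a).symm
  | cons r h ih => simp only [pathSum, ih, mul_add]

theorem pathSum_mono (hc : ∀ r h', r :: h' <:+ h → c r h' ≤ c' r h') :
    pathSum c h ≤ pathSum c' h := by
  induction h with
  | nil => exact le_rfl
  | cons r h ih =>
    exact add_le_add (hc r h List.suffix_rfl)
      (ih fun r' h' hs => hc r' h' (hs.trans (List.suffix_cons r h)))

theorem pathSum_nonneg (hc : ∀ r h, 0 ≤ c r h) (h : List α) : 0 ≤ pathSum c h := by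
  induction h with
  | nil => exact le_rfl
  | cons r h ih => exact add_nonneg (hc r h) ih

theorem pathSum_le_length_mul {a : ℝ} (hc : ∀ r h', r :: h' <:+ h → c r h' ≤ a) :
    pathSum c h ≤ h.length * a := by
  induction h with
  | nil => simp [pathSum]
  | cons r h ih =>
    have htail := ih fun r' h' hs => hc r' h' (hs.trans (List.suffix_cons r h))
    rw [pathSum, List.length_cons, Nat.cast_succ]
    linarith [hc r h List.suffix_rfl]

theorem pathSum_telescope (F : List α → ℝ) (h : List α) :
    pathSum (fun r h => F (r :: h) - F h) h = F h - F [] := by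
  induction h with
  | nil => exact (sub_self _).symm
  | cons r h ih => rw [pathSum, ih, sub_add_sub_cancel]

end PathSums

section ExpectedPathSums

variable {m : ℕ} [NeZero m] (d : Fin m → ℕ+) (K T : ℕ)

theorem expectation_pathSum_succ (c : (Fin m → ℕ) × Realization d K → History d K → ℝ) :
    expectation (clcbHistory d K (T + 1)) (pathSum c) =
      expectation (clcbHistory d K T) (fun h =>
        expectation (greedyAllocation (nextBound h) K) fun k =>
          expectation (realizationLaw d K) fun φ => c (k, φ) h) +
      expectation (clcbHistory d K T) (pathSum c) := by
  rw [expectation_clcbHistory_succ, ← expectation_add (finite_support_clcbHistory d K T)]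
  refine congrArg _ (funext fun h => ?_)
  have hg := finite_support_greedyAllocation (nextBound h) K
  have hr := finite_support_realizationLaw d K
  simp only [nextExpectation, pathSum, expectation_add hr, expectation_add hg,
    expectation_const hr, expectation_const hg]

theorem expectation_pathSum_indicator (S : Set (History d K)) :
    expectation (clcbHistory d K T) (pathSum fun _ => S.indicator 1) =
      ∑ n ∈ Finset.range T, probability (clcbHistory d K n) S := by
  induction T with
  | zero => rw [clcbHistory, expectation_pure, pathSum, Finset.sum_range_zero]
  | succ T ih =>
    simp only [expectation_pathSum_succ, ih, Finset.sum_range_succ, add_comm, probability,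
      expectation_const (finite_support_realizationLaw d K),
      expectation_const (finite_support_greedyAllocation _ K)]

theorem regret_eq (kstar : Fin m → ℕ) :
    regret d K kstar T =
      expectation (clcbHistory d K T) (pathSum fun r _ => gap d K kstar r.1) := by
  have hr := finite_support_realizationLaw d K
  have hpath : ∀ h : History d K,
      (h.map fun r => (reward kstar r.2 : ℝ) - (reward r.1 r.2 : ℝ)).sum =
        pathSum (fun r _ => (reward kstar r.2 : ℝ) - (reward r.1 r.2 : ℝ)) h := fun h => by
    induction h with
    | nil => rfl
    | cons r h ih => rw [List.map_cons, List.sum_cons, ih, pathSum]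
  simp only [regret, hpath]
  induction T with
  | zero => simp only [clcbHistory, expectation_pure, pathSum]
  | succ T ih =>
    simp only [expectation_pathSum_succ, ih, expectation_sub hr, expectation_const hr]
    rfl

end ExpectedPathSums

section ConfidenceBounds

variable {m : ℕ} {d : Fin m → ℕ+} {K : ℕ} {h : History d K} {i : Fin m}

theorem nextBound_le_collisionProb (hg : h ∈ goodHistories d K) (i : Fin m) :
    nextBound h i ≤ collisionProb d i := by
  refine max_le (collisionProb_pos d i).le ?_
  by_cases hp : pairCount h i = 0
  · simp [empiricalMean, confidenceRadius, hp, (collisionProb_pos d i).le]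
  · linarith [(abs_le.1 (hg i hp)).2]

theorem collisionProb_sub_nextBound_le (hg : h ∈ goodHistories d K) (hp : pairCount h i ≠ 0) :
    collisionProb d i - nextBound h i ≤ 2 * nextRadius h i := by
  have hlow : empiricalMean h i - nextRadius h i ≤ nextBound h i := le_max_right _ _
  linarith [(abs_le.1 (hg i hp)).1]

theorem pairCount_ne_zero_of_nextBound_pos (hpos : 0 < nextBound h i) : pairCount h i ≠ 0 := by
  intro hp
  simp [lowerConfidenceBound, empiricalMean, confidenceRadius, hp] at hpos

theorem pairCount_le_of_le_nextRadius {x : ℝ} (hx : 0 < x) (hle : x ≤ nextRadius h i) :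
    (pairCount h i : ℝ) ≤ 3 * Real.log (h.length + 1 : ℕ) / (2 * x ^ 2) := by
  have hlog : 0 ≤ Real.log (h.length + 1 : ℕ) := Real.log_natCast_nonneg _
  by_cases hp : pairCount h i = 0
  · rw [hp, Nat.cast_zero]
    positivity
  · have hpos : (0 : ℝ) < pairCount h i := Nat.cast_pos.2 (Nat.pos_of_ne_zero hp)
    rw [nextRadius, confidenceRadius, if_neg hp, Real.le_sqrt hx.le (by positivity),
      le_div_iff₀ (by positivity)] at hle
    rw [le_div_iff₀ (by positivity)]
    linarith

theorem pairCount_le_of_nextBound_eq_zero (hg : h ∈ goodHistories d K) (h0 : nextBound h i = 0) :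
    (pairCount h i : ℝ) ≤ 6 * Real.log (h.length + 1 : ℕ) / collisionProb d i ^ 2 := by
  have hμ := collisionProb_pos d i
  by_cases hp : pairCount h i = 0
  · have : 0 ≤ Real.log (h.length + 1 : ℕ) := Real.log_natCast_nonneg _
    rw [hp, Nat.cast_zero]
    positivity
  · have hradius := collisionProb_sub_nextBound_le hg hp
    rw [h0, sub_zero] at hradius
    refine (pairCount_le_of_le_nextRadius (half_pos hμ) (by linarith)).trans_eq ?_
    field_simp
    ring

end ConfidenceBounds

section GoodRounds

variable {m : ℕ} [NeZero m] {d : Fin m → ℕ+} {K : ℕ} {kstar k : Fin m → ℕ} {h : History d K}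

/-- The allocation is optimal for the confidence bounds, which overestimate the rewards. -/
theorem gap_le_sum_geomReward_sub (hg : h ∈ goodHistories d K)
    (hopt : IsOptimalAllocation d K kstar) (hk : IsPlayable h k) :
    gap d K kstar k ≤
      ∑ i, (geomReward (nextBound h i) (k i) - geomReward (collisionProb d i) (k i)) := by
  rw [gap, expectedReward_eq d hopt.1, expectedReward_eq d hk.sum_eq.le, Finset.sum_sub_distrib]
  refine sub_le_sub_right ?_ _
  calc ∑ i, geomReward (collisionProb d i) (kstar i)
      ≤ ∑ i, geomReward (nextBound h i) (kstar i) :=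
        Finset.sum_le_sum fun i _ =>
          geomReward_anti (nextBound_le_collisionProb hg i) (collisionProb_le_one d i) _
    _ ≤ ∑ i, geomReward (nextBound h i) (k i) :=
        hk.isGreedy.sum_geomReward_le (nextBound_nonneg h) (nextBound_le_one h)
          (hopt.1.trans hk.sum_eq.ge)

theorem gap_le_sum_mul_min (hg : h ∈ goodHistories d K) (hopt : IsOptimalAllocation d K kstar)
    (hk : IsPlayable h k) (hpos : ∀ i, 0 < nextBound h i) :
    gap d K kstar k ≤ ∑ i, (k i : ℝ) * (k i - 1) / 2 * min 1 (2 * nextRadius h i) := by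
  refine (gap_le_sum_geomReward_sub hg hopt hk).trans (Finset.sum_le_sum fun i _ => ?_)
  refine (geomReward_sub_geomReward_le (nextBound_nonneg h i) (nextBound_le_collisionProb hg i)
    (collisionProb_le_one d i) (k i)).trans (mul_le_mul_of_nonneg_left (le_min ?_ ?_) ?_)
  · linarith [collisionProb_le_one d i, nextBound_nonneg h i]
  · exact collisionProb_sub_nextBound_le hg (pairCount_ne_zero_of_nextBound_pos (hpos i))
  · rw [← Nat.cast_choose_two]
    exact Nat.cast_nonneg _

theorem sub_one_le_two_mul_div_two (n : ℕ) : (n : ℝ) - 1 ≤ 2 * (n / 2 : ℕ) := by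
  have hn : n ≤ 2 * (n / 2) + 1 := by omega
  rw [sub_le_iff_le_add]
  exact_mod_cast hn

theorem sub_one_mul_sub_le_two_mul_max {n : ℕ} {q δ a b : ℝ} (hn : 1 ≤ n) (hnq : n ≤ q)
    (hδ : 0 ≤ δ) (hba : b ≤ a) :
    ((n : ℝ) - 1) * (n * δ - a) ≤ 2 * (n / 2 : ℕ) * max 0 (q * δ - b) :=
  calc ((n : ℝ) - 1) * (n * δ - a)
      ≤ ((n : ℝ) - 1) * max 0 (q * δ - b) :=
        mul_le_mul_of_nonneg_left (le_max_of_le_right (by gcongr))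
          (sub_nonneg.2 (Nat.one_le_cast.2 hn))
    _ ≤ 2 * (n / 2 : ℕ) * max 0 (q * δ - b) :=
        mul_le_mul_of_nonneg_right (sub_one_le_two_mul_div_two n) (le_max_left _ _)

/-- A part `gap / (K - m)` of the gap is charged to each of the `K - m` units beyond the first
one of every community, so that only communities with a large confidence radius pay. -/
theorem gap_le_of_forall_nextBound_pos (hg : h ∈ goodHistories d K)
    (hopt : IsOptimalAllocation d K kstar) (hm : m < K) (hk : IsPlayable h k)
    (hpos : ∀ i, 0 < nextBound h i) :
    gap d K kstar k ≤ ∑ i, 2 * ((k i / 2 : ℕ) : ℝ) *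
      max 0 ((K - m + 1 : ℕ) * min 1 (2 * nextRadius h i) -
        (invGapMin d K kstar i)⁻¹ / (K - m : ℕ)) := by
  set g := gap d K kstar k
  rcases le_or_gt g 0 with hle | hgap
  · exact hle.trans (Finset.sum_nonneg fun i _ => mul_nonneg (by positivity) (le_max_left _ _))
  have hone : ∀ i, 1 ≤ k i :=
    hk.isGreedy.one_le hpos (nextBound_le_one h) (by simpa [hk.sum_eq] using hm.le)
  have hKm : (0 : ℝ) < (K - m : ℕ) := Nat.cast_pos.2 (Nat.sub_pos_of_lt hm)
  have hunits : ∑ i, ((k i : ℝ) - 1) = (K - m : ℕ) := by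
    simp [Nat.cast_sub hm.le, ← Nat.cast_sum, hk.sum_eq]
  have haverage : g = 2 * g - ∑ i, ((k i : ℝ) - 1) * (g / (K - m : ℕ)) := by
    rw [← Finset.sum_mul, hunits, mul_div_cancel₀ _ hKm.ne']
    ring
  calc g ≤ 2 * ∑ i, (k i : ℝ) * (k i - 1) / 2 * min 1 (2 * nextRadius h i) -
        ∑ i, ((k i : ℝ) - 1) * (g / (K - m : ℕ)) := by
        linarith [gap_le_sum_mul_min hg hopt hk hpos]
    _ = ∑ i, ((k i : ℝ) - 1) * (k i * min 1 (2 * nextRadius h i) - g / (K - m : ℕ)) := by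
        rw [Finset.mul_sum, ← Finset.sum_sub_distrib]
        exact Finset.sum_congr rfl fun i _ => by ring
    _ ≤ _ := Finset.sum_le_sum fun i _ => ?_
  rcases (hone i).eq_or_lt with hi | hi
  · simp [← hi]
  · have hki : (k i : ℝ) ≤ (K - m + 1 : ℕ) := by
      have hadd := add_card_le_sum_add_one hone i
      rw [hk.sum_eq, Fintype.card_fin] at hadd
      exact Nat.cast_le.2 (by omega)
    have hinv : (invGapMin d K kstar i)⁻¹ ≤ g :=
      inv_le_of_inv_le₀ hgap (inv_gap_le_invGapMin ⟨hk.sum_eq, hgap, hi⟩)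
    exact sub_one_mul_sub_le_two_mul_max (hone i) hki
      (le_min zero_le_one (mul_nonneg zero_le_two (confidenceRadius_nonneg _ h i)))
      (div_le_div_of_nonneg_right hinv hKm.le)

theorem IsPlayable.nextBound_eq_zero (hk : IsPlayable h k) {i j : Fin m} (hj : nextBound h j = 0)
    (hi : 1 < k i) : nextBound h i = 0 := by
  by_contra hne
  exact hi.not_ge (hk.isGreedy.le_one_of_eq_zero ((nextBound_nonneg h i).lt_of_ne' hne)
    (nextBound_le_one h i) hj)

theorem gap_le_of_nextBound_eq_zero (hg : h ∈ goodHistories d K)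
    (hopt : IsOptimalAllocation d K kstar) (hk : IsPlayable h k) {j : Fin m}
    (hj : nextBound h j = 0) :
    gap d K kstar k ≤ ∑ i, if nextBound h i = 0 ∧ 1 < k i then
      K * min 1 ((k i / 2 : ℕ) * collisionProb d i) else 0 := by
  refine (gap_le_sum_geomReward_sub hg hopt hk).trans (Finset.sum_le_sum fun i _ => ?_)
  have hμ := (collisionProb_pos d i).le
  have hμ1 := collisionProb_le_one d i
  rcases le_or_gt (k i) 1 with hi | hi
  · rw [if_neg fun h => h.2.not_ge hi]
    interval_cases k i <;> simp [geomReward]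
  have hzero := hk.nextBound_eq_zero hj hi
  have hkK : (k i : ℝ) ≤ K := Nat.cast_le.2 (hk.le i)
  have hki : (1 : ℝ) ≤ k i := Nat.one_le_cast.2 hi.le
  rw [if_pos ⟨hzero, hi⟩, hzero, mul_min_of_nonneg _ _ (Nat.cast_nonneg K), mul_one]
  refine le_min ?_ ?_
  · linarith [geomReward_le le_rfl zero_le_one (k i), geomReward_nonneg hμ1 (k i)]
  · calc geomReward 0 (k i) - geomReward (collisionProb d i) (k i)
        ≤ (k i : ℝ) * (k i - 1) / 2 * (collisionProb d i - 0) :=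
          geomReward_sub_geomReward_le le_rfl hμ hμ1 (k i)
      _ ≤ K * (2 * (k i / 2 : ℕ)) / 2 * (collisionProb d i - 0) := by
          gcongr
          exact sub_one_le_two_mul_div_two (k i)
      _ = K * ((k i / 2 : ℕ) * collisionProb d i) := by ring

end GoodRounds

section TruncatedInverseSqrt

variable {a b : ℝ}

/-- The function `y ↦ -max 0 (a - b * √y) ^ 2 / b` has the derivative `max 0 (a / √y - b)`. -/
theorem max_div_sqrt_sub_le (ha : 0 ≤ a) (hb : 0 < b) (y : ℕ) :
    max 0 (a / √(y + 1 : ℕ) - b) ≤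
      (max 0 (a - b * √y) ^ 2 - max 0 (a - b * √(y + 1 : ℕ)) ^ 2) / b := by
  have hs : 0 < √(y + 1 : ℕ) := Real.sqrt_pos.2 (Nat.cast_pos.2 y.succ_pos)
  have hle : √y ≤ √(y + 1 : ℕ) := Real.sqrt_le_sqrt (Nat.cast_le.2 y.le_succ)
  have hsq : √(y + 1 : ℕ) ^ 2 = √y ^ 2 + 1 := by
    rw [Real.sq_sqrt (Nat.cast_nonneg _), Real.sq_sqrt (Nat.cast_nonneg _), Nat.cast_succ]
  generalize √(y + 1 : ℕ) = s at *
  generalize √y = r at *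
  refine max_le (div_nonneg (sub_nonneg.2 ?_) hb.le) ?_
  · gcongr
  rcases le_or_gt a (b * s) with hsmall | hlarge
  · have hnonpos : a / s - b ≤ 0 := sub_nonpos.2 ((div_le_iff₀ hs).2 hsmall)
    rw [max_eq_left (sub_nonpos.2 hsmall), zero_pow two_ne_zero, sub_zero]
    exact hnonpos.trans (by positivity)
  · have hr : b * r ≤ b * s := mul_le_mul_of_nonneg_left hle hb.le
    rw [max_eq_right (by linarith), max_eq_right (by linarith)]
    calc a / s - b = a * (s ^ 2 - r ^ 2) / s - b := by rw [hsq, add_sub_cancel_left, mul_one]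
      _ ≤ a * (2 * (s - r)) - b := by
          gcongr
          rw [div_le_iff₀ hs, mul_assoc]
          gcongr
          linarith [sq_nonneg (s - r)]
      _ = ((a - b * r) ^ 2 - (a - b * s) ^ 2) / b := by
          field_simp
          linear_combination b ^ 2 * hsq

theorem sum_max_div_sqrt_sub_le (ha : 0 ≤ a) (hb : 0 < b) (n : ℕ) :
    ∑ y ∈ Finset.range n, max 0 (a / √(y + 1 : ℕ) - b) ≤ a ^ 2 / b := by
  let F : ℕ → ℝ := fun y => max 0 (a - b * √y) ^ 2 / b
  calc ∑ y ∈ Finset.range n, max 0 (a / √(y + 1 : ℕ) - b)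
      ≤ ∑ y ∈ Finset.range n, (F y - F (y + 1)) := Finset.sum_le_sum fun y _ =>
        (max_div_sqrt_sub_le ha hb y).trans_eq (sub_div _ _ _)
    _ = F 0 - F n := Finset.sum_range_sub' F n
    _ ≤ F 0 := sub_le_self _ (by positivity)
    _ = a ^ 2 / b := by simp [F, ha]

end TruncatedInverseSqrt

section DelayedSum

variable {f : ℕ → ℝ}

/-- The sum of the first `x` values of `f` after a delay of `q` steps, which are charged `f 0`
each. It is used as a potential of the pair counts: when `n ≤ q + 1` pairs are observed at once,
each of them is charged the value of `f` at the number of pairs seen before, or an earlier one. -/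
noncomputable def delayedSum (f : ℕ → ℝ) (q x : ℕ) : ℝ := ∑ z ∈ Finset.range x, f (z - q)

theorem delayedSum_mono (hf : ∀ y, 0 ≤ f y) (q : ℕ) : Monotone (delayedSum f q) :=
  monotone_nat_of_le_succ fun x => by
    rw [delayedSum, delayedSum, Finset.sum_range_succ]
    exact le_add_of_nonneg_right (hf _)

theorem mul_le_delayedSum_sub {q n s : ℕ} {v : ℝ} (hn : n ≤ q + 1) (hv : ∀ y ≤ s, v ≤ f y) :
    n * v ≤ delayedSum f q (n + s) - delayedSum f q s := by
  rw [delayedSum, delayedSum, add_comm n s, Finset.sum_range_add, add_sub_cancel_left]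
  calc n * v = ∑ _ ∈ Finset.range n, v := by simp
    _ ≤ ∑ z ∈ Finset.range n, f (s + z - q) := Finset.sum_le_sum fun z hz => hv _ <| by
        have hz' := Finset.mem_range.1 hz
        omega

theorem delayedSum_le (hf : ∀ y, 0 ≤ f y) (q x : ℕ) :
    delayedSum f q x ≤ (q + 1) * f 0 + ∑ y ∈ Finset.range x, f (y + 1) := by
  calc delayedSum f q x ≤ delayedSum f q (q + 1 + x) := delayedSum_mono hf q (by omega)
    _ = ∑ z ∈ Finset.range (q + 1), f (z - q) + ∑ y ∈ Finset.range x, f (q + 1 + y - q) :=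
        Finset.sum_range_add _ _ _
    _ = (q + 1) * f 0 + ∑ y ∈ Finset.range x, f (y + 1) := by
        congr 1
        · rw [Finset.sum_congr rfl fun z hz => congrArg f (Nat.sub_eq_zero_of_le
            (Nat.lt_succ_iff.1 (Finset.mem_range.1 hz)))]
          simp
        · exact Finset.sum_congr rfl fun y _ => congrArg f (by omega)

end DelayedSum

section CappedLinear

variable {A c e : ℝ}

/-- The potential that grows by `c` per pair up to the threshold `A` and jumps by `e` beyond it. -/
noncomputable def cappedLinear (A c e : ℝ) (x : ℕ) : ℝ :=
  c * min (x : ℝ) A + if A < x then e else 0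

theorem cappedLinear_mono (hc : 0 ≤ c) (he : 0 ≤ e) : Monotone (cappedLinear A c e) := by
  intro x y hxy
  have hxy' : (x : ℝ) ≤ y := Nat.cast_le.2 hxy
  refine add_le_add (by gcongr) ?_
  split_ifs <;> linarith

theorem min_le_cappedLinear_sub (hc : 0 ≤ c) {n s : ℕ} (hs : s ≤ A) :
    min e (c * n) ≤ cappedLinear A c e (n + s) - cappedLinear A c e s := by
  unfold cappedLinear
  rw [min_eq_left hs, if_neg hs.not_gt]
  split_ifs with hlarge
  · rw [min_eq_right hlarge.le]
    linarith [min_le_left e (c * n), mul_le_mul_of_nonneg_left hs hc]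
  · rw [min_eq_left (not_lt.1 hlarge), Nat.cast_add]
    linarith [min_le_right e (c * n)]

theorem cappedLinear_le (hc : 0 ≤ c) (he : 0 ≤ e) (x : ℕ) : cappedLinear A c e x ≤ c * A + e := by
  refine add_le_add (mul_le_mul_of_nonneg_left (min_le_right _ _) hc) ?_
  split_ifs
  exacts [le_rfl, he]

theorem cappedLinear_zero (hA : 0 ≤ A) : cappedLinear A c e 0 = 0 := by
  simp [cappedLinear, hA, hA.not_gt]

end CappedLinear

section Charging

variable {m : ℕ} {d : Fin m → ℕ+} {K : ℕ} {kstar k : Fin m → ℕ} {h : History d K} {L : ℝ}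
  {i : Fin m}

theorem nextRadius_le {y : ℕ} (hL : Real.log (h.length + 1 : ℕ) ≤ L) (hy : y ≠ 0)
    (hle : y ≤ pairCount h i) : nextRadius h i ≤ √(3 * L / 2) / √y := by
  have : (0 : ℝ) < y := Nat.cast_pos.2 (Nat.pos_of_ne_zero hy)
  have hle' : (y : ℝ) ≤ pairCount h i := Nat.cast_le.2 hle
  have hlog : 0 ≤ L := (Real.log_natCast_nonneg _).trans hL
  rw [nextRadius, confidenceRadius, if_neg (by omega), ← Real.sqrt_div (by positivity), div_div]
  gcongr

variable (d K kstar L i) in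
/-- A bound on what every pair of members of community `i` is charged in a good round with
positive confidence bounds up to the time `exp L`, when at least `y` pairs were seen before. -/
noncomputable def pairCost (y : ℕ) : ℝ :=
  2 * if y = 0 then ((K - m + 1 : ℕ) : ℝ) else
    max 0 (2 * (K - m + 1 : ℕ) * √(3 * L / 2) / √y - (invGapMin d K kstar i)⁻¹ / (K - m : ℕ))

theorem pairCost_nonneg (y : ℕ) : 0 ≤ pairCost d K kstar L i y := by
  unfold pairCost
  split_ifs <;> positivity

theorem charge_le_pairCost {y : ℕ} (hL : Real.log (h.length + 1 : ℕ) ≤ L)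
    (hy : y ≤ pairCount h i) :
    2 * max 0 ((K - m + 1 : ℕ) * min 1 (2 * nextRadius h i) -
      (invGapMin d K kstar i)⁻¹ / (K - m : ℕ)) ≤ pairCost d K kstar L i y := by
  have hκ : (0 : ℝ) ≤ (K - m + 1 : ℕ) := Nat.cast_nonneg _
  have hb : 0 ≤ (invGapMin d K kstar i)⁻¹ / (K - m : ℕ) :=
    div_nonneg (inv_nonneg.2 (invGapMin_nonneg i)) (Nat.cast_nonneg _)
  unfold pairCost
  refine mul_le_mul_of_nonneg_left ?_ zero_le_two
  split_ifs with h0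
  · exact max_le hκ ((sub_le_self _ hb).trans (mul_le_of_le_one_right hκ (min_le_left _ _)))
  · refine max_le_max le_rfl (sub_le_sub_right ?_ _)
    calc (K - m + 1 : ℕ) * min 1 (2 * nextRadius h i)
        ≤ (K - m + 1 : ℕ) * (2 * (√(3 * L / 2) / √y)) :=
          mul_le_mul_of_nonneg_left (min_le_of_right_le
            (mul_le_mul_of_nonneg_left (nextRadius_le hL h0 hy) zero_le_two)) hκ
      _ = 2 * (K - m + 1 : ℕ) * √(3 * L / 2) / √y := by ring

theorem delayedSum_pairCost_le (hL : 0 ≤ L) (hm : m < K) (hi : 0 < invGapMin d K kstar i)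
    (x : ℕ) :
    delayedSum (pairCost d K kstar L i) ((K - m + 1) / 2 - 1) x ≤
      (K - m + 1 : ℕ) ^ 2 + 12 * (K - m + 1 : ℕ) ^ 2 * (K - m : ℕ) * L * invGapMin d K kstar i := by
  set κ := K - m + 1
  set a := 2 * κ * √(3 * L / 2)
  set b := (invGapMin d K kstar i)⁻¹ / (K - m : ℕ)
  have hKm : (0 : ℝ) < (K - m : ℕ) := Nat.cast_pos.2 (Nat.sub_pos_of_lt hm)
  have hhalf : (((κ / 2 - 1 : ℕ) : ℝ) + 1) * 2 ≤ κ := by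
    exact_mod_cast (by omega : (κ / 2 - 1 + 1) * 2 ≤ κ)
  refine (delayedSum_le pairCost_nonneg _ x).trans (add_le_add ?_ ?_)
  · calc ((κ / 2 - 1 : ℕ) + 1) * pairCost d K kstar L i 0
        = (((κ / 2 - 1 : ℕ) : ℝ) + 1) * 2 * κ := by rw [pairCost, if_pos rfl, mul_assoc]
      _ ≤ (κ : ℝ) ^ 2 := by rw [sq]; gcongr
  · calc ∑ y ∈ Finset.range x, pairCost d K kstar L i (y + 1)
        = 2 * ∑ y ∈ Finset.range x, max 0 (a / √(y + 1 : ℕ) - b) := by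
          simp only [pairCost, Nat.succ_ne_zero, if_false, ← Finset.mul_sum, a, b, κ]
      _ ≤ 2 * (a ^ 2 / b) := mul_le_mul_of_nonneg_left
          (sum_max_div_sqrt_sub_le (by positivity) (by positivity) x) zero_le_two
      _ = 12 * κ ^ 2 * (K - m : ℕ) * L * invGapMin d K kstar i := by
          rw [mul_pow, mul_pow, Real.sq_sqrt (by positivity), div_div_eq_mul_div, div_inv_eq_mul]
          ring

variable (d K) in
/-- The histories after which all the lower confidence bounds are positive. -/
def positiveHistories : Set (History d K) := {h | ∀ i, 0 < nextBound h i}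

variable [NeZero m]

theorem gap_le_sum_delayedSum_sub (hh : h ∈ goodHistories d K ∩ positiveHistories d K)
    (hopt : IsOptimalAllocation d K kstar) (hm : m < K) (hk : IsPlayable h k)
    (hL : Real.log (h.length + 1 : ℕ) ≤ L) :
    gap d K kstar k ≤
      ∑ i, (delayedSum (pairCost d K kstar L i) ((K - m + 1) / 2 - 1) (k i / 2 + pairCount h i) -
        delayedSum (pairCost d K kstar L i) ((K - m + 1) / 2 - 1) (pairCount h i)) := by
  have hone : ∀ i, 1 ≤ k i :=
    hk.isGreedy.one_le hh.2 (nextBound_le_one h) (by simpa [hk.sum_eq] using hm.le)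
  refine (gap_le_of_forall_nextBound_pos hh.1 hopt hm hk hh.2).trans
    (Finset.sum_le_sum fun i _ => ?_)
  have hki := add_card_le_sum_add_one hone i
  rw [hk.sum_eq, Fintype.card_fin] at hki
  rw [mul_comm (2 : ℝ), mul_assoc]
  exact mul_le_delayedSum_sub (by omega) fun y hy => charge_le_pairCost hL hy

theorem gap_le_sum_cappedLinear_sub (hh : h ∈ goodHistories d K \ positiveHistories d K)
    (hopt : IsOptimalAllocation d K kstar) (hk : IsPlayable h k)
    (hL : Real.log (h.length + 1 : ℕ) ≤ L) :
    gap d K kstar k ≤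
      ∑ i, (cappedLinear (6 * L / collisionProb d i ^ 2) (K * collisionProb d i) K
          (k i / 2 + pairCount h i) -
        cappedLinear (6 * L / collisionProb d i ^ 2) (K * collisionProb d i) K
          (pairCount h i)) := by
  obtain ⟨j, hj⟩ : ∃ j, nextBound h j ≤ 0 := by
    simpa [positiveHistories] using hh.2
  refine (gap_le_of_nextBound_eq_zero hh.1 hopt hk (hj.antisymm (nextBound_nonneg h j))).trans
    (Finset.sum_le_sum fun i _ => ?_)
  have hc : 0 ≤ K * collisionProb d i := mul_nonneg (Nat.cast_nonneg K) (collisionProb_pos d i).le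
  split_ifs with hi
  · have hcount : (pairCount h i : ℝ) ≤ 6 * L / collisionProb d i ^ 2 :=
      (pairCount_le_of_nextBound_eq_zero hh.1 hi.1).trans (by gcongr)
    refine le_of_eq_of_le ?_ (min_le_cappedLinear_sub hc hcount)
    rw [mul_min_of_nonneg _ _ (Nat.cast_nonneg K), mul_one, mul_assoc,
      mul_comm (collisionProb d i)]
  · exact sub_nonneg.2 (cappedLinear_mono hc (Nat.cast_nonneg K) (Nat.le_add_left _ _))

end Charging

section RegretDecomposition

variable {m : ℕ} {d : Fin m → ℕ+} {K : ℕ} {kstar : Fin m → ℕ} {h : History d K}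

theorem pathSum_indicator_le_sum_sub {S : Set (History d K)}
    {c : (Fin m → ℕ) × Realization d K → History d K → ℝ} {Ψ : Fin m → ℕ → ℝ}
    (hΨ : ∀ i, Monotone (Ψ i))
    (hc : ∀ r h', r :: h' <:+ h → h' ∈ S →
      c r h' ≤ ∑ i, (Ψ i (r.1 i / 2 + pairCount h' i) - Ψ i (pairCount h' i))) :
    pathSum (fun r => S.indicator (c r)) h ≤ ∑ i, (Ψ i (pairCount h i) - Ψ i 0) := by
  let F : History d K → ℝ := fun h => ∑ i, Ψ i (pairCount h i)
  calc pathSum (fun r => S.indicator (c r)) h ≤ pathSum (fun r h' => F (r :: h') - F h') h :=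
        pathSum_mono fun r h' hs => by
          simp only [F, pairCount_cons, ← Finset.sum_sub_distrib]
          exact Set.indicator_apply_le' (hc r h' hs) fun _ =>
            Finset.sum_nonneg fun i _ => sub_nonneg.2 (hΨ i (Nat.le_add_left _ _))
    _ = ∑ i, (Ψ i (pairCount h i) - Ψ i 0) := by
        rw [pathSum_telescope, Finset.sum_sub_distrib]
        rfl

theorem log_length_succ_le {α : Type*} {r : α} {h h' : List α} (hs : r :: h' <:+ h) :
    Real.log (h'.length + 1 : ℕ) ≤ Real.log h.length :=
  Real.log_le_log (Nat.cast_pos.2 h'.length.succ_pos) (Nat.cast_le.2 hs.length_le)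

variable [NeZero m]

theorem pathSum_gap_positive_le (hh : IsReachable h) (hopt : IsOptimalAllocation d K kstar)
    (hm : m < K) (hinv : ∀ i, 0 < invGapMin d K kstar i) :
    pathSum (fun r => (goodHistories d K ∩ positiveHistories d K).indicator
        fun _ => gap d K kstar r.1) h ≤
      ∑ i, ((K - m + 1 : ℕ) ^ 2 + 12 * (K - m + 1 : ℕ) ^ 2 * (K - m : ℕ) * Real.log h.length *
        invGapMin d K kstar i) := by
  have hlog : 0 ≤ Real.log h.length := Real.log_natCast_nonneg _
  let Ψ : Fin m → ℕ → ℝ := fun i =>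
    delayedSum (pairCost d K kstar (Real.log h.length) i) ((K - m + 1) / 2 - 1)
  have hΨ : ∀ i, Monotone (Ψ i) := fun i => delayedSum_mono pairCost_nonneg _
  refine (pathSum_indicator_le_sum_sub hΨ fun r h' hs hh' =>
    gap_le_sum_delayedSum_sub hh' hopt hm (hh.isPlayable hs) (log_length_succ_le hs)).trans
      (Finset.sum_le_sum fun i _ => ?_)
  rw [show Ψ i 0 = 0 from Finset.sum_range_zero _, sub_zero]
  exact delayedSum_pairCost_le hlog hm (hinv i) _

theorem pathSum_gap_not_positive_le (hh : IsReachable h) (hopt : IsOptimalAllocation d K kstar) :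
    pathSum (fun r => (goodHistories d K \ positiveHistories d K).indicator
        fun _ => gap d K kstar r.1) h ≤
      ∑ i, (6 * K * Real.log h.length * (collisionProb d i)⁻¹ + K) := by
  have : 0 ≤ Real.log h.length := Real.log_natCast_nonneg _
  have hc : ∀ i, 0 ≤ K * collisionProb d i := fun i =>
    mul_nonneg (Nat.cast_nonneg K) (collisionProb_pos d i).le
  refine (pathSum_indicator_le_sum_sub (fun i => cappedLinear_mono (hc i) (Nat.cast_nonneg K))
    fun r h' hs hh' => gap_le_sum_cappedLinear_sub hh' hopt (hh.isPlayable hs)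
      (log_length_succ_le hs)).trans (Finset.sum_le_sum fun i _ => ?_)
  rw [cappedLinear_zero (by positivity), sub_zero]
  refine (cappedLinear_le (hc i) (Nat.cast_nonneg K) _).trans_eq ?_
  have hp := (collisionProb_pos d i).ne'
  field_simp

theorem pathSum_gap_le (hh : IsReachable h) (hm : m < K) :
    pathSum (fun r _ => gap d K kstar r.1) h ≤
      pathSum (fun r => (goodHistories d K ∩ positiveHistories d K).indicator
        fun _ => gap d K kstar r.1) h +
      pathSum (fun r => (goodHistories d K \ positiveHistories d K).indicator
        fun _ => gap d K kstar r.1) h +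
      gapMax d K kstar * pathSum (fun _ => (goodHistories d K)ᶜ.indicator 1) h := by
  rw [← pathSum_const_mul, ← pathSum_add, ← pathSum_add]
  refine pathSum_mono fun r h' hs => ?_
  have hmax := gap_le_gapMax (d := d) (kstar := kstar) hm (hh.isPlayable hs).sum_eq
  by_cases hgood : h' ∈ goodHistories d K <;> by_cases hpos : h' ∈ positiveHistories d K <;>
    simp [hgood, hpos, hmax]

variable (d) in
theorem regret_le_mul {a : ℝ} (ha : ∀ k, ∑ i, k i = K → gap d K kstar k ≤ a) (T : ℕ) :
    regret d K kstar T ≤ T * a := by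
  have hfin := finite_support_clcbHistory d K T
  rw [regret_eq, ← expectation_const hfin (T * a)]
  refine expectation_mono hfin fun h hh => ?_
  obtain ⟨rfl, hreach⟩ := length_and_isReachable_of_mem_support hh
  refine pathSum_le_length_mul fun r h' hs => ha _ (hreach.isPlayable hs).sum_eq

end RegretDecomposition

section BadRounds

theorem sum_range_le_add_div {P : ℕ → ℝ} {C : ℝ} {B : ℕ} (hB : B ≠ 0) (hC : 0 ≤ C)
    (h0 : ∀ n, 0 ≤ P n) (h1 : ∀ n, P n ≤ 1) (hP : ∀ n, P n ≤ C / (n + 1 : ℝ) ^ 2) (T : ℕ) :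
    ∑ n ∈ Finset.range T, P n ≤ B + C / B := by
  have htail : ∑ n ∈ Finset.Ico B (B + T), C / (n + 1 : ℝ) ^ 2 ≤ C / B :=
    calc ∑ n ∈ Finset.Ico B (B + T), C / (n + 1 : ℝ) ^ 2
        = C * ∑ n ∈ Finset.Ioc B (B + T), ((n : ℝ) ^ 2)⁻¹ := by
          rw [← Finset.Ico_add_one_add_one_eq_Ioc, ← Finset.sum_Ico_add', Finset.mul_sum]
          simp only [div_eq_mul_inv, Nat.cast_add_one]
      _ ≤ C * (B : ℝ)⁻¹ := by
          gcongr
          exact (sum_Ioc_inv_sq_le_sub hB (Nat.le_add_right B T)).trans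
            (sub_le_self _ (by positivity))
      _ = C / B := (div_eq_mul_inv _ _).symm
  calc ∑ n ∈ Finset.range T, P n ≤ ∑ n ∈ Finset.range (B + T), P n :=
        Finset.sum_le_sum_of_subset_of_nonneg (Finset.range_mono (Nat.le_add_left T B))
          fun n _ _ => h0 n
    _ = ∑ n ∈ Finset.range B, P n + ∑ n ∈ Finset.Ico B (B + T), P n :=
        (Finset.sum_range_add_sum_Ico _ (Nat.le_add_right B T)).symm
    _ ≤ B + C / B := add_le_add
        ((Finset.sum_le_card_nsmul _ _ _ fun n _ => h1 n).trans_eq (by simp))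
        ((Finset.sum_le_sum fun n _ => hP n).trans htail)

theorem half_le_mul_half {m K : ℕ} (hm2 : 2 ≤ m) (hm : m < K) :
    K / 2 ≤ m * ((K - m + 1) / 2) := by
  have hhalf : 1 ≤ (K - m + 1) / 2 := by omega
  have hmul : m + 2 * ((K - m + 1) / 2) ≤ m * ((K - m + 1) / 2) + 2 := by nlinarith
  omega

variable {m : ℕ} [NeZero m] (d : Fin m → ℕ+) {K : ℕ}

theorem sum_probability_compl_goodHistories_le (hm2 : 2 ≤ m) (hm : m < K) (T : ℕ) :
    ∑ n ∈ Finset.range T, probability (clcbHistory d K n) (goodHistories d K)ᶜ ≤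
      3 * (m * ((K - m + 1) / 2 : ℕ)) := by
  set q := (K - m + 1) / 2
  have hq : 1 ≤ q := by omega
  have hmq : m ≤ m * q := Nat.le_mul_of_pos_right m hq
  have hhalf : ((K / 2 : ℕ) : ℝ) ≤ (m * q : ℕ) := Nat.cast_le.2 (half_le_mul_half hm2 hm)
  calc ∑ n ∈ Finset.range T, probability (clcbHistory d K n) (goodHistories d K)ᶜ
      ≤ (m * q : ℕ) + 2 * m * (m * q : ℕ) / (m * q : ℕ) := by
        refine sum_range_le_add_div (by omega) (by positivity)
          (fun n => probability_nonneg _ _)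
          (fun n => probability_le_one (finite_support_clcbHistory d K n) _) (fun n => ?_) T
        exact (probability_compl_goodHistories_le d K n).trans (by gcongr)
    _ = (m * q : ℕ) + 2 * m := by
        rw [mul_div_assoc, div_self (Nat.cast_ne_zero.2 (by omega)), mul_one]
    _ ≤ 3 * (m * q) := by
        have hmq' : (m : ℝ) ≤ m * q := by exact_mod_cast hmq
        push_cast
        linarith

end BadRounds

section LogRegret

variable {m : ℕ} {d : Fin m → ℕ+} {K : ℕ} {kstar : Fin m → ℕ}

theorem log_regret_term_le {κ Q L v w : ℝ} (hκ : 2 ≤ κ) (hQ : κ ≤ Q) (hL : 1 / 2 ≤ L)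
    (hw1 : 1 ≤ w) (hw : w ≤ κ * v) :
    κ ^ 2 + 12 * κ ^ 2 * (κ - 1) * L * v + (6 * Q * L * w + Q) ≤
      48 * (κ * (κ - 1) / 2) * Q * L * v + 2 * (κ * (κ - 1) / 2) := by
  have hQ0 : 0 ≤ Q := by linarith
  have hLx : L ≤ L * (κ * v) := le_mul_of_one_le_right (by linarith) (hw1.trans hw)
  have hcoef : 6 * Q ≤ 24 * (κ - 1) * Q - 12 * κ * (κ - 1) - 6 * Q := by nlinarith
  have hkey : 3 * Q ≤ L * (κ * v) * (24 * (κ - 1) * Q - 12 * κ * (κ - 1) - 6 * Q) :=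
    calc 3 * Q ≤ L * (6 * Q) := by nlinarith
      _ ≤ L * (κ * v) * (6 * Q) := mul_le_mul_of_nonneg_right hLx (by positivity)
      _ ≤ _ := mul_le_mul_of_nonneg_left hcoef (by linarith)
  have hterm : 6 * Q * L * w ≤ 6 * Q * L * (κ * v) :=
    mul_le_mul_of_nonneg_left hw (by positivity)
  linarith

theorem three_mul_le_pi_sq_mul :
    gapMax d K kstar * (3 * (m * ((K - m + 1) / 2 : ℕ))) ≤
      ((K - m + 1) / 2 : ℕ) * Real.pi ^ 2 / 3 * m * gapMax d K kstar := by
  have hpi : (3 : ℝ) ≤ Real.pi ^ 2 / 3 := by nlinarith [Real.pi_gt_three]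
  calc gapMax d K kstar * (3 * (m * ((K - m + 1) / 2 : ℕ)))
      ≤ gapMax d K kstar * (Real.pi ^ 2 / 3 * (m * ((K - m + 1) / 2 : ℕ))) :=
        mul_le_mul_of_nonneg_left (mul_le_mul_of_nonneg_right hpi (by positivity)) gapMax_nonneg
    _ = ((K - m + 1) / 2 : ℕ) * Real.pi ^ 2 / 3 * m * gapMax d K kstar := by ring

variable [NeZero m]

theorem inv_collisionProb_le_mul_invGapMin (hopt : IsOptimalAllocation d K kstar) (hm2 : 2 ≤ m)
    (hm : m < K) (i : Fin m) :
    (collisionProb d i)⁻¹ ≤ (K - m + 1 : ℕ) * invGapMin d K kstar i := by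
  have : Nontrivial (Fin m) := Fin.nontrivial_iff_two_le.2 hm2
  obtain ⟨j, hj⟩ := exists_ne i
  have hle := inv_mul_collisionProb_le_invGapMin hopt hm hj.symm
  rwa [mul_inv, inv_mul_le_iff₀ (Nat.cast_pos.2 (Nat.succ_pos _))] at hle

theorem invGapMin_pos (hopt : IsOptimalAllocation d K kstar) (hm2 : 2 ≤ m) (hm : m < K)
    (i : Fin m) : 0 < invGapMin d K kstar i :=
  pos_of_mul_pos_right ((inv_pos.2 (collisionProb_pos d i)).trans_le
    (inv_collisionProb_le_mul_invGapMin hopt hm2 hm i)) (Nat.cast_nonneg _)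

theorem regret_le_add (hopt : IsOptimalAllocation d K kstar) (hm2 : 2 ≤ m) (hm : m < K) (T : ℕ) :
    regret d K kstar T ≤
      ∑ i, ((K - m + 1 : ℕ) ^ 2 + 12 * (K - m + 1 : ℕ) ^ 2 * (K - m : ℕ) * Real.log T *
        invGapMin d K kstar i) +
      expectation (clcbHistory d K T) (pathSum fun r =>
        (goodHistories d K \ positiveHistories d K).indicator fun _ => gap d K kstar r.1) +
      gapMax d K kstar * (3 * (m * ((K - m + 1) / 2 : ℕ))) := by
  have hfin := finite_support_clcbHistory d K T
  rw [regret_eq]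
  refine le_trans ?_ (add_le_add_right (mul_le_mul_of_nonneg_left
    (sum_probability_compl_goodHistories_le d hm2 hm T) gapMax_nonneg) _)
  rw [← expectation_pathSum_indicator, ← expectation_const_mul, ← expectation_const hfin (∑ i, _),
    ← expectation_add hfin, ← expectation_add hfin]
  refine expectation_mono hfin fun h hh => ?_
  obtain ⟨rfl, hreach⟩ := length_and_isReachable_of_mem_support hh
  refine (pathSum_gap_le hreach hm).trans (add_le_add_left (add_le_add_left ?_ _) _)
  exact pathSum_gap_positive_le hreach hopt hm (invGapMin_pos hopt hm2 hm)

theorem expectation_pathSum_gap_not_positive_le (hopt : IsOptimalAllocation d K kstar) (T : ℕ) :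
    expectation (clcbHistory d K T) (pathSum fun r =>
        (goodHistories d K \ positiveHistories d K).indicator fun _ => gap d K kstar r.1) ≤
      ∑ i, (6 * K * Real.log T * (collisionProb d i)⁻¹ + K) := by
  have hfin := finite_support_clcbHistory d K T
  rw [← expectation_const hfin (∑ i, _)]
  refine expectation_mono hfin fun h hh => ?_
  obtain ⟨rfl, hreach⟩ := length_and_isReachable_of_mem_support hh
  exact pathSum_gap_not_positive_le hreach hopt

theorem regret_le_log_of_two_le (hopt : IsOptimalAllocation d K kstar) (hm2 : 2 ≤ m) (hm : m < K)
    {T : ℕ} (hT : 2 ≤ T) :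
    regret d K kstar T ≤
      (∑ i, 48 * ((K - m + 1).choose 2 : ℝ) * K * Real.log T * invGapMin d K kstar i)
        + 2 * ((K - m + 1).choose 2 : ℝ) * m
        + ((K - m + 1) / 2 : ℕ) * Real.pi ^ 2 / 3 * m * gapMax d K kstar := by
  have hL : 1 / 2 ≤ Real.log T := by
    have hlog : Real.log 2 ≤ Real.log T := Real.log_le_log two_pos (by exact_mod_cast hT)
    linarith [Real.log_two_gt_d9]
  have hterm : ∀ i, ((K - m + 1 : ℕ) ^ 2 + 12 * (K - m + 1 : ℕ) ^ 2 * (K - m : ℕ) * Real.log T *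
        invGapMin d K kstar i) + (6 * K * Real.log T * (collisionProb d i)⁻¹ + K) ≤
      48 * ((K - m + 1).choose 2 : ℝ) * K * Real.log T * invGapMin d K kstar i +
        2 * ((K - m + 1).choose 2 : ℝ) := fun i => by
    rw [Nat.cast_choose_two, show ((K - m : ℕ) : ℝ) = (K - m + 1 : ℕ) - 1 by push_cast; ring]
    exact log_regret_term_le (by exact_mod_cast (by omega : 2 ≤ K - m + 1))
      (Nat.cast_le.2 (by omega)) hL
      ((one_le_inv₀ (collisionProb_pos d i)).2 (collisionProb_le_one d i))
      (inv_collisionProb_le_mul_invGapMin hopt hm2 hm i)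
  refine (regret_le_add hopt hm2 hm T).trans (add_le_add ?_ three_mul_le_pi_sq_mul)
  refine (add_le_add_right (expectation_pathSum_gap_not_positive_le hopt T) _).trans ?_
  rw [← Finset.sum_add_distrib]
  refine (Finset.sum_le_sum fun i _ => hterm i).trans_eq ?_
  rw [Finset.sum_add_distrib, Finset.sum_const, Finset.card_univ, Fintype.card_fin, nsmul_eq_mul,
    mul_comm (m : ℝ)]

theorem regret_nonpos_of_subsingleton [Subsingleton (Fin m)]
    (hopt : IsOptimalAllocation d K kstar) (T : ℕ) : regret d K kstar T ≤ 0 :=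
  (regret_le_mul d (fun _ hk => (gap_eq_zero_of_subsingleton hopt hk).le) T).trans_eq
    (mul_zero _)

theorem regret_one_le (hm2 : 2 ≤ m) (hm : m < K) :
    regret d K kstar 1 ≤ gapMax d K kstar * (3 * (m * ((K - m + 1) / 2 : ℕ))) := by
  have hone : (1 : ℝ) ≤ (m * ((K - m + 1) / 2) : ℕ) :=
    Nat.one_le_cast.2 (Nat.mul_pos (by omega) (by omega))
  refine (regret_le_mul d (fun _ hk => gap_le_gapMax hm hk) 1).trans ?_
  rw [Nat.cast_one, one_mul]
  refine le_mul_of_one_le_right gapMax_nonneg ?_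
  push_cast at hone
  linarith

theorem regret_le_log (hopt : IsOptimalAllocation d K kstar) (hm : m < K) {T : ℕ} (hT : 1 ≤ T) :
    regret d K kstar T ≤
      (∑ i, 48 * ((K - m + 1).choose 2 : ℝ) * K * Real.log T * invGapMin d K kstar i)
        + 2 * ((K - m + 1).choose 2 : ℝ) * m
        + ((K - m + 1) / 2 : ℕ) * Real.pi ^ 2 / 3 * m * gapMax d K kstar := by
  have hsum : 0 ≤ ∑ i, 48 * ((K - m + 1).choose 2 : ℝ) * K * Real.log T *
      invGapMin d K kstar i := Finset.sum_nonneg fun i _ =>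
    mul_nonneg (by positivity) (invGapMin_nonneg i)
  have hmax : 0 ≤ gapMax d K kstar := gapMax_nonneg
  rcases Nat.lt_or_ge m 2 with hm1 | hm2
  · have : Subsingleton (Fin m) := Fin.subsingleton_iff_le_one.2 (by omega)
    exact (regret_nonpos_of_subsingleton hopt T).trans (by positivity)
  rcases hT.eq_or_lt with rfl | hT2
  · exact ((regret_one_le hm2 hm).trans three_mul_le_pi_sq_mul).trans
      (le_add_of_nonneg_left (by positivity))
  · exact regret_le_log_of_two_le hopt hm2 hm hT2

end LogRegret

section Windows

theorem le_add_pathSum_indicator_le_length {α : Type*} (N : ℕ) (h : List α) :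
    (h.length : ℝ) ≤ N + pathSum (fun _ => {g : List α | N ≤ g.length}.indicator 1) h := by
  induction h with
  | nil => simp [pathSum]
  | cons r h ih =>
    have hnonneg : 0 ≤ pathSum (fun _ => {g : List α | N ≤ g.length}.indicator 1) h :=
      pathSum_nonneg (fun _ => Set.indicator_nonneg fun _ _ => zero_le_one) h
    rw [pathSum, List.length_cons, Nat.cast_succ, Set.indicator_apply, Pi.one_apply]
    split_ifs with hN
    · linarith
    · have hlt : h.length < N := not_le.1 hN
      have hle : (h.length : ℝ) + 1 ≤ N := by exact_mod_cast hlt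
      linarith

theorem pathSum_indicator_length_lt_le {α : Type*} (N : ℕ) (h : List α) :
    pathSum (fun _ => {g : List α | g.length < N}.indicator 1) h ≤ N := by
  let F : List α → ℝ := fun h => min (h.length : ℝ) N
  calc pathSum (fun _ => {g : List α | g.length < N}.indicator 1) h
      ≤ pathSum (fun r h => F (r :: h) - F h) h := pathSum_mono fun r g _ => by
        have hle : (g.length : ℝ) ≤ (r :: g).length := Nat.cast_le.2 (by simp)
        refine Set.indicator_apply_le' (fun hg => ?_) fun _ =>
          sub_nonneg.2 (min_le_min_right _ hle)
        have hg' : ((r :: g).length : ℝ) ≤ N := Nat.cast_le.2 hg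
        simp only [F, min_eq_left hg', min_eq_left (hle.trans hg')]
        simp
    _ = F h - F [] := pathSum_telescope F h
    _ ≤ N := (sub_le_self _ (by simp [F])).trans (min_le_right _ _)

variable {m : ℕ} {d : Fin m → ℕ+} {K : ℕ} {h : History d K} {S : Set (History d K)} {A : ℝ}

theorem pathSum_indicator_le_of_pairCount_le (hA : 0 ≤ A)
    (hS : ∀ (r : (Fin m → ℕ) × Realization d K) h', r :: h' <:+ h → h' ∈ S →
      ∃ i, 1 < r.1 i ∧ pairCount h' i ≤ A) :
    pathSum (fun _ => S.indicator 1) h ≤ m * (A + 1) := by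
  let Ψ : ℕ → ℝ := fun x => min (x : ℝ) (A + 1)
  have hΨ : Monotone Ψ := fun x y hxy => min_le_min_right _ (Nat.cast_le.2 hxy)
  refine (pathSum_indicator_le_sum_sub (Ψ := fun _ => Ψ) (fun _ => hΨ) fun r h' hs hh' => ?_).trans
    ((Finset.sum_le_card_nsmul _ _ (A + 1) fun i _ => ?_).trans_eq (by simp [mul_add_one]))
  · obtain ⟨i, hi, hiA⟩ := hS r h' hs hh'
    have hhalf : (1 : ℝ) ≤ (r.1 i / 2 : ℕ) := Nat.one_le_cast.2 (by omega)
    refine le_trans ?_ (Finset.single_le_sum (fun j _ => sub_nonneg.2 (hΨ (Nat.le_add_left _ _)))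
      (Finset.mem_univ i))
    simp only [Ψ, Nat.cast_add, Pi.one_apply]
    rw [min_eq_left (by linarith : (pairCount h' i : ℝ) ≤ A + 1), le_sub_iff_add_le, le_min_iff]
    constructor <;> linarith
  · simp only [Ψ, Nat.cast_zero, min_eq_left (by linarith : (0 : ℝ) ≤ A + 1), sub_zero]
    exact min_le_right _ _

theorem exists_round_lt_pairCount {N : ℕ} (hA : 0 ≤ A) (hN : N + m * (A + 1) < h.length) :
    ∃ (r : (Fin m → ℕ) × Realization d K) (g : History d K),
      r :: g <:+ h ∧ N ≤ g.length ∧ ∀ j, 1 < r.1 j → A < pairCount g j := by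
  by_contra! hcon
  have hle := pathSum_indicator_le_of_pairCount_le (S := {g | N ≤ g.length}) hA hcon
  linarith [le_add_pathSum_indicator_le_length N h]

theorem pairCount_mono {h' : History d K} (hs : h' <:+ h) (i : Fin m) :
    pairCount h' i ≤ pairCount h i := by
  obtain ⟨l, rfl⟩ := hs
  simp [pairCount]

end Windows

section Deviations

variable {m : ℕ} {d : Fin m → ℕ+} {K : ℕ} {η w L : ℝ} {h g : History d K} {i : Fin m}

variable (d K η w) in
/-- The histories in the course of which an empirical mean of at least `w` observations deviates
by at least `η` from its expectation. -/
def deviatingHistories : Set (History d K) :=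
  {h | ∃ i h', h' <:+ h ∧ w ≤ pairCount h' i ∧ η ≤ |empiricalMean h' i - collisionProb d i|}

theorem notMem_deviatingHistories_of_suffix (hdev : h ∉ deviatingHistories d K η w)
    (hs : g <:+ h) : g ∉ deviatingHistories d K η w :=
  fun ⟨i, g', hs', hg'⟩ => hdev ⟨i, g', hs'.trans hs, hg'⟩

theorem abs_sub_lt_of_notMem_deviatingHistories (hdev : h ∉ deviatingHistories d K η w)
    (hs : g <:+ h) (hw : w ≤ pairCount g i) : |empiricalMean g i - collisionProb d i| < η := by
  by_contra! hcon
  exact hdev ⟨i, g, hs, hw, hcon⟩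

theorem four_mul_le_nextBound (hη : 0 < η) (hdev : h ∉ deviatingHistories d K η w) (hs : g <:+ h)
    (hμ : 6 * η ≤ collisionProb d i) (hL : Real.log (g.length + 1 : ℕ) ≤ L)
    (hw : w ≤ 3 * L / (2 * η ^ 2)) (hp : 3 * L / (2 * η ^ 2) < pairCount g i) :
    4 * η ≤ nextBound g i := by
  have hmean := (abs_lt.1 (abs_sub_lt_of_notMem_deviatingHistories hdev hs (hw.trans hp.le))).1
  have hradius : nextRadius g i < η := by
    by_contra! hcon
    refine hp.not_ge ((pairCount_le_of_le_nextRadius hη hcon).trans ?_)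
    gcongr
  exact le_max_of_le_right (by linarith)

theorem nextRadius_le_add (hη : 0 ≤ η) (hs : g <:+ h) (hg : pairCount g i ≠ 0)
    (hle : nextRadius g i ≤ 1)
    (hlog : Real.log (h.length + 1 : ℕ) ≤ (1 + η ^ 2) * Real.log (g.length + 1 : ℕ)) :
    nextRadius h i ≤ nextRadius g i + η := by
  have hmono : (pairCount g i : ℝ) ≤ pairCount h i := Nat.cast_le.2 (pairCount_mono hs i)
  have : (0 : ℝ) < pairCount g i := Nat.cast_pos.2 (Nat.pos_of_ne_zero hg)
  have : 0 ≤ Real.log (g.length + 1 : ℕ) := Real.log_natCast_nonneg _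
  have h0 := confidenceRadius_nonneg (g.length + 1) g i
  have hsq : nextRadius g i ^ 2 = 3 * Real.log (g.length + 1 : ℕ) / (2 * pairCount g i) := by
    rw [nextRadius, confidenceRadius, if_neg hg, Real.sq_sqrt (by positivity)]
  have hne : pairCount h i ≠ 0 := by
    have := pairCount_mono hs i
    omega
  calc nextRadius h i = √(3 * Real.log (h.length + 1 : ℕ) / (2 * pairCount h i)) := by
        rw [nextRadius, confidenceRadius, if_neg hne]
    _ ≤ √((1 + η ^ 2) * nextRadius g i ^ 2) := by
        rw [hsq, ← mul_div_assoc, mul_left_comm]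
        gcongr
    _ ≤ nextRadius g i + η := Real.sqrt_le_iff.2 ⟨by positivity, by
        nlinarith [mul_le_mul_of_nonneg_left (pow_le_one₀ h0 hle : nextRadius g i ^ 2 ≤ 1)
          (sq_nonneg η), mul_nonneg h0 hη]⟩

theorem nextBound_pos_of_suffix (hη : 0 < η) (hdev : h ∉ deviatingHistories d K η w)
    (hs : g <:+ h) (hbound : 4 * η ≤ nextBound g i)
    (hw : w ≤ 3 / 2 * Real.log (g.length + 1 : ℕ))
    (hlog : Real.log (h.length + 1 : ℕ) ≤ (1 + η ^ 2) * Real.log (g.length + 1 : ℕ)) :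
    0 < nextBound h i := by
  have hdiff : 4 * η ≤ empiricalMean g i - nextRadius g i :=
    (le_max_iff.1 hbound).resolve_left (by linarith)
  have hradius : nextRadius g i ≤ 1 := by linarith [empiricalMean_le_one g i]
  have hg : pairCount g i ≠ 0 := pairCount_ne_zero_of_nextBound_pos (by linarith)
  have hcount : w ≤ pairCount g i := by
    have hpos : (0 : ℝ) < pairCount g i := Nat.cast_pos.2 (Nat.pos_of_ne_zero hg)
    rw [nextRadius, confidenceRadius, if_neg hg, Real.sqrt_le_one, div_le_one (by positivity)]
      at hradius
    linarith
  have hmeang := abs_lt.1 (abs_sub_lt_of_notMem_deviatingHistories hdev hs hcount)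
  have hmeanh := abs_lt.1 (abs_sub_lt_of_notMem_deviatingHistories hdev List.suffix_rfl
    (hcount.trans (Nat.cast_le.2 (pairCount_mono hs i))))
  have hadd := nextRadius_le_add hη.le hs hg hradius hlog
  exact lt_max_of_lt_right (by linarith)

variable [NeZero m]

theorem probability_deviatingHistories_le (hη : 0 ≤ η) (hw : 0 < w) (T : ℕ) :
    probability (clcbHistory d K T) (deviatingHistories d K η w) ≤
      m * (2 * Real.exp (-(2 * η ^ 2 * w))) := by
  refine (probability_le_sum (s := Finset.univ) (finite_support_clcbHistory d K T) ?_).trans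
    ((Finset.sum_le_card_nsmul _ _ _ fun i _ =>
      probability_exists_deviation_le i hη hw T).trans_eq (by simp))
  rintro h - ⟨i, hi⟩
  exact ⟨i, Finset.mem_univ i, hi⟩

/-- In a window before the last round, some round explores only well-explored communities more
than once. Their lower confidence bounds are large, and since this round is greedy so are those of
the communities that it explores only once; this persists until the last round. -/
theorem mem_positiveHistories_of_window {N : ℕ} (hη : 0 < η)
    (hμ : ∀ j, 6 * η ≤ collisionProb d j) (hm : m < K) (hh : IsReachable h)
    (hdev : h ∉ deviatingHistories d K η w) (hw : w ≤ 3 / 2 * Real.log (N + 1 : ℕ))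
    (hwindow : N + m * (3 * Real.log (h.length + 1 : ℕ) / (2 * η ^ 2) + 1) < h.length)
    (hlog : Real.log (h.length + 1 : ℕ) ≤ (1 + η ^ 2) * Real.log (N + 1 : ℕ)) :
    h ∈ positiveHistories d K := by
  intro i
  set L := Real.log (h.length + 1 : ℕ)
  have hL : 0 ≤ L := Real.log_natCast_nonneg _
  obtain ⟨r, g, hs, hNg, hwell⟩ := exists_round_lt_pairCount (by positivity) hwindow
  have hgs : g <:+ h := (List.suffix_cons r g).trans hs
  have hNL : Real.log (N + 1 : ℕ) ≤ Real.log (g.length + 1 : ℕ) :=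
    Real.log_le_log (by positivity) (Nat.cast_le.2 (Nat.succ_le_succ hNg))
  have hgL : Real.log (g.length + 1 : ℕ) ≤ L :=
    Real.log_le_log (by positivity) (Nat.cast_le.2 (Nat.succ_le_succ hgs.length_le))
  have hwA : w ≤ 3 * L / (2 * η ^ 2) := by
    have hη1 : η ^ 2 ≤ 1 := pow_le_one₀ hη.le (by linarith [hμ i, collisionProb_le_one d i])
    rw [le_div_iff₀ (by positivity)]
    nlinarith
  have hplay := hh.isPlayable hs
  have hgreedy := hplay.isGreedy
  have hcard : Fintype.card (Fin m) < ∑ j, r.1 j := by rwa [hplay.sum_eq, Fintype.card_fin]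
  obtain ⟨j, hj⟩ := exists_one_lt_of_card_lt_sum hcard
  have hboundj := four_mul_le_nextBound hη hdev hgs (hμ j) hgL hwA (hwell j hj)
  have hpos : ∀ l, 0 < nextBound g l := fun l => by
    by_contra! hl
    exact hj.not_ge (hgreedy.le_one_of_eq_zero (by linarith) (nextBound_le_one g j)
      (hl.antisymm (nextBound_nonneg g l)))
  have hone := hgreedy.one_le hpos (nextBound_le_one g) hcard.le i
  have hboundi : 4 * η ≤ nextBound g i := by
    rcases hone.eq_or_lt with hi | hi
    · exact hboundj.trans (hgreedy.le_of_eq_one_of_one_lt (nextBound_nonneg g j)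
        (nextBound_le_one g j) hi.symm hj)
    · exact four_mul_le_nextBound hη hdev hgs (hμ i) hgL hwA (hwell i hi)
  exact nextBound_pos_of_suffix hη hdev hgs hboundi (by linarith)
    (hlog.trans (mul_le_mul_of_nonneg_left hNL (by positivity)))

end Deviations

section AsymptoticRegret

open Filter Asymptotics

variable {m : ℕ} {d : Fin m → ℕ+} {K : ℕ} {kstar : Fin m → ℕ} {h : History d K} {η w ε : ℝ}

theorem tendsto_log_natCast_atTop : Tendsto (fun n : ℕ => Real.log n) atTop atTop :=
  Real.tendsto_log_atTop.comp tendsto_natCast_atTop_atTop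

theorem eventually_window (m : ℕ) (hη : 0 < η) (w : ℝ) :
    ∀ᶠ n : ℕ in atTop, w ≤ 3 / 2 * Real.log (n / 2 + 1 : ℕ) ∧
      (n / 2 : ℕ) + m * (3 * Real.log (n + 1 : ℕ) / (2 * η ^ 2) + 1) < n ∧
      Real.log (n + 1 : ℕ) ≤ (1 + η ^ 2) * Real.log (n / 2 + 1 : ℕ) := by
  have hhalf : Tendsto (fun n : ℕ => Real.log (n / 2 + 1 : ℕ)) atTop atTop :=
    tendsto_log_natCast_atTop.comp ((tendsto_add_atTop_nat 1).comp
      (Nat.tendsto_div_const_atTop two_ne_zero))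
  have hlog : (fun n : ℕ => m * (3 / (2 * η ^ 2) * Real.log (n + 1 : ℕ) + 1))
      =o[atTop] fun n : ℕ => ((n + 1 : ℕ) : ℝ) := by
    have hsucc : Tendsto (fun n : ℕ => ((n + 1 : ℕ) : ℝ)) atTop atTop :=
      tendsto_natCast_atTop_atTop.comp (tendsto_add_atTop_nat 1)
    exact ((((Real.isLittleO_log_id_atTop.comp_tendsto hsucc).const_mul_left _).add
      ((isLittleO_const_id_atTop 1).comp_tendsto hsucc)).const_mul_left _)
  filter_upwards [hhalf.eventually_ge_atTop (2 / 3 * w),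
    hhalf.eventually_ge_atTop (Real.log 2 / η ^ 2), hlog.bound (by norm_num : (0 : ℝ) < 1 / 4),
    eventually_gt_atTop 1] with n hw hlog2 hbound hn
  have hn1 : (1 : ℝ) < n := Nat.one_lt_cast.2 hn
  refine ⟨by linarith, ?_, ?_⟩
  · have hle := (le_abs_self _).trans hbound
    have hdiv : ((n / 2 : ℕ) : ℝ) ≤ n / 2 := Nat.cast_div_le
    rw [Real.norm_natCast] at hle
    push_cast at hle ⊢
    rw [mul_div_right_comm]
    linarith
  · have hdouble : ((n + 1 : ℕ) : ℝ) ≤ 2 * (n / 2 + 1 : ℕ) := by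
      exact_mod_cast (by omega : n + 1 ≤ 2 * (n / 2 + 1))
    have hle := Real.log_le_log (by positivity) hdouble
    rw [Real.log_mul two_ne_zero (by positivity)] at hle
    rw [div_le_iff₀' (by positivity)] at hlog2
    linarith

variable [NeZero m]

theorem exists_mem_positiveHistories (hη : 0 < η) (hμ : ∀ j, 6 * η ≤ collisionProb d j)
    (hm : m < K) (w : ℝ) :
    ∃ N : ℕ, ∀ h : History d K, IsReachable h → h ∉ deviatingHistories d K η w →
      N ≤ h.length → h ∈ positiveHistories d K := by
  obtain ⟨N, hN⟩ := eventually_atTop.1 (eventually_window m hη w)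
  refine ⟨N, fun h hh hdev hle => ?_⟩
  obtain ⟨hw, hwindow, hlog⟩ := hN h.length hle
  exact mem_positiveHistories_of_window hη hμ hm hh hdev hw hwindow hlog

theorem pathSum_indicator_not_positive_le (hη : 0 < η) (hμ : ∀ j, 6 * η ≤ collisionProb d j)
    (hm : m < K) (hh : IsReachable h) :
    pathSum (fun _ => (goodHistories d K \ positiveHistories d K).indicator 1) h ≤
      m * (Real.log h.length / (6 * η ^ 2) + 1) := by
  have : 0 ≤ Real.log h.length := Real.log_natCast_nonneg _
  refine pathSum_indicator_le_of_pairCount_le (by positivity) fun r h' hs hh' => ?_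
  have hplay := hh.isPlayable hs
  obtain ⟨j, hj⟩ : ∃ j, nextBound h' j ≤ 0 := by
    simpa [positiveHistories] using hh'.2
  obtain ⟨i, hi⟩ := exists_one_lt_of_card_lt_sum (k := r.1)
    (by rwa [hplay.sum_eq, Fintype.card_fin])
  have hzero := hplay.nextBound_eq_zero (hj.antisymm (nextBound_nonneg h' j)) hi
  refine ⟨i, hi, (pairCount_le_of_nextBound_eq_zero hh'.1 hzero).trans ?_⟩
  calc 6 * Real.log (h'.length + 1 : ℕ) / collisionProb d i ^ 2
      ≤ 6 * Real.log h.length / (6 * η) ^ 2 := by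
        gcongr
        exacts [hs.length_le, hμ i]
    _ = Real.log h.length / (6 * η ^ 2) := by
        field_simp

theorem exists_expectation_not_positive_le (hη : 0 < η) (hμ : ∀ j, 6 * η ≤ collisionProb d j)
    (hm : m < K) (hw : 0 < w) :
    ∃ N : ℕ, ∀ T, expectation (clcbHistory d K T)
        (pathSum fun _ => (goodHistories d K \ positiveHistories d K).indicator 1) ≤
      N + m * (Real.log T / (6 * η ^ 2) + 1) * (m * (2 * Real.exp (-(2 * η ^ 2 * w)))) := by
  obtain ⟨N, hN⟩ := exists_mem_positiveHistories hη hμ hm w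
  refine ⟨N, fun T => ?_⟩
  have hfin := finite_support_clcbHistory d K T
  have hlog : 0 ≤ Real.log T := Real.log_natCast_nonneg T
  calc expectation (clcbHistory d K T)
        (pathSum fun _ => (goodHistories d K \ positiveHistories d K).indicator 1)
      ≤ expectation (clcbHistory d K T) fun h => N +
          m * (Real.log T / (6 * η ^ 2) + 1) * (deviatingHistories d K η w).indicator 1 h := by
        refine expectation_mono hfin fun h hh => ?_
        obtain ⟨rfl, hreach⟩ := length_and_isReachable_of_mem_support hh
        by_cases hdev : h ∈ deviatingHistories d K η w
        · rw [Set.indicator_of_mem hdev, Pi.one_apply, mul_one]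
          exact (pathSum_indicator_not_positive_le hη hμ hm hreach).trans
            (le_add_of_nonneg_left (Nat.cast_nonneg N))
        · rw [Set.indicator_of_notMem hdev, mul_zero, add_zero]
          refine (pathSum_mono fun r g hs => ?_).trans (pathSum_indicator_length_lt_le N h)
          have hgs : g <:+ h := (List.suffix_cons r g).trans hs
          refine Set.indicator_apply_le' (fun hg => ?_) fun _ =>
            Set.indicator_nonneg (fun _ _ => zero_le_one) g
          have hlt : g.length < N := by
            by_contra! hle
            exact hg.2 (hN g (hreach.of_suffix hgs)
              (notMem_deviatingHistories_of_suffix hdev hgs) hle)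
          exact (Set.indicator_of_mem (s := {g : History d K | g.length < N}) hlt 1).ge
    _ = N + m * (Real.log T / (6 * η ^ 2) + 1) *
          probability (clcbHistory d K T) (deviatingHistories d K η w) := by
        rw [expectation_add hfin, expectation_const hfin, expectation_const_mul, probability]
    _ ≤ _ := by
        gcongr
        exact probability_deviatingHistories_le hη.le hw T

theorem eventually_expectation_not_positive_le (hm : m < K) (hε : 0 < ε) :
    ∀ᶠ T : ℕ in atTop, expectation (clcbHistory d K T)
        (pathSum fun _ => (goodHistories d K \ positiveHistories d K).indicator 1) ≤
      ε * Real.log T := by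
  obtain ⟨i, hi⟩ := Finite.exists_min (collisionProb d)
  obtain ⟨η, hη, hμ⟩ : ∃ η, 0 < η ∧ ∀ j, 6 * η ≤ collisionProb d j :=
    ⟨collisionProb d i / 6, by linarith [collisionProb_pos d i], fun j => by linarith [hi j]⟩
  have htendsto :
      Tendsto (fun w => m * (m * (2 * Real.exp (-(2 * η ^ 2 * w))))) atTop (nhds 0) := by
    have hexp := Real.tendsto_exp_neg_atTop_nhds_zero.comp
      (tendsto_id.const_mul_atTop (by positivity : 0 < 2 * η ^ 2))
    simpa using ((hexp.const_mul 2).const_mul (m : ℝ)).const_mul (m : ℝ)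
  obtain ⟨w, hwε, hw⟩ := ((htendsto.eventually_le_const
    (by positivity : 0 < 3 * η ^ 2 * ε)).and (eventually_gt_atTop 0)).exists
  obtain ⟨N, hN⟩ := exists_expectation_not_positive_le hη hμ hm hw
  filter_upwards [tendsto_log_natCast_atTop.eventually_ge_atTop ((N + 3 * η ^ 2 * ε) / (ε / 2))]
    with T hT
  rw [div_le_iff₀' (by positivity)] at hT
  have hlog : 0 ≤ Real.log T / (6 * η ^ 2) + 1 := by positivity
  have hmain := mul_le_mul_of_nonneg_left hwε hlog
  have hsplit : (Real.log T / (6 * η ^ 2) + 1) * (3 * η ^ 2 * ε) =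
      ε / 2 * Real.log T + 3 * η ^ 2 * ε := by
    field_simp
    ring
  linarith [hN T]

theorem expectation_pathSum_gap_le_mul (hm : m < K) (S : Set (History d K)) (T : ℕ) :
    expectation (clcbHistory d K T) (pathSum fun r => S.indicator fun _ => gap d K kstar r.1) ≤
      gapMax d K kstar * expectation (clcbHistory d K T) (pathSum fun _ => S.indicator 1) := by
  rw [← expectation_const_mul]
  refine expectation_mono (finite_support_clcbHistory d K T) fun h hh => ?_
  have hreach := (length_and_isReachable_of_mem_support hh).2
  rw [← pathSum_const_mul]
  refine pathSum_mono fun r h' hs => ?_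
  have hmax := gap_le_gapMax (d := d) (kstar := kstar) hm (hreach.isPlayable hs).sum_eq
  by_cases hh' : h' ∈ S <;> simp [hh', hmax]

theorem regret_le_of_expectation_le (hopt : IsOptimalAllocation d K kstar) (hm2 : 2 ≤ m)
    (hm : m < K) {T : ℕ} {x : ℝ} (hx : expectation (clcbHistory d K T)
      (pathSum fun _ => (goodHistories d K \ positiveHistories d K).indicator 1) ≤ x) :
    regret d K kstar T ≤
      12 * ∑ i, ((K - m + 1 : ℕ) : ℝ) ^ 3 * Real.log T * invGapMin d K kstar i +
        gapMax d K kstar * x + (m * ((K - m + 1 : ℕ) : ℝ) ^ 2 +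
          gapMax d K kstar * (3 * (m * ((K - m + 1) / 2 : ℕ)))) := by
  have hterm : ∀ i, ((K - m + 1 : ℕ) : ℝ) ^ 2 + 12 * (K - m + 1 : ℕ) ^ 2 * (K - m : ℕ) *
        Real.log T * invGapMin d K kstar i ≤ ((K - m + 1 : ℕ) : ℝ) ^ 2 +
      12 * (((K - m + 1 : ℕ) : ℝ) ^ 3 * Real.log T * invGapMin d K kstar i) := fun i => by
    have hle : ((K - m : ℕ) : ℝ) ≤ (K - m + 1 : ℕ) := Nat.cast_le.2 (Nat.le_succ _)
    have hv := invGapMin_nonneg (d := d) (K := K) (kstar := kstar) i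
    have : 0 ≤ Real.log T := Real.log_natCast_nonneg T
    rw [pow_succ _ 2, ← mul_assoc, ← mul_assoc, ← mul_assoc]
    gcongr
  have hsum := (Finset.sum_le_sum fun i (_ : i ∈ Finset.univ) => hterm i).trans_eq
    Finset.sum_add_distrib
  rw [Finset.sum_const, Finset.card_univ, Fintype.card_fin, nsmul_eq_mul, ← Finset.mul_sum] at hsum
  have hgap := (expectation_pathSum_gap_le_mul (kstar := kstar) hm
    (goodHistories d K \ positiveHistories d K) T).trans
      (mul_le_mul_of_nonneg_left hx gapMax_nonneg)
  linarith [regret_le_add hopt hm2 hm T]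

theorem eventually_regret_le (hopt : IsOptimalAllocation d K kstar) (hm : m < K) :
    ∀ᶠ T : ℕ in atTop, regret d K kstar T ≤
      13 * ∑ i, ((K - m + 1 : ℕ) : ℝ) ^ 3 * Real.log T * invGapMin d K kstar i := by
  rcases Nat.lt_or_ge m 2 with hm1 | hm2
  · have : Subsingleton (Fin m) := Fin.subsingleton_iff_le_one.2 (by omega)
    refine Eventually.of_forall fun T => (regret_nonpos_of_subsingleton hopt T).trans ?_
    have : 0 ≤ Real.log T := Real.log_natCast_nonneg T
    exact mul_nonneg (by norm_num) (Finset.sum_nonneg fun i _ =>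
      mul_nonneg (by positivity) (invGapMin_nonneg i))
  set s := ∑ i, ((K - m + 1 : ℕ) : ℝ) ^ 3 * invGapMin d K kstar i with hs
  have hspos : 0 < s := Finset.sum_pos
    (fun i _ => mul_pos (by positivity) (invGapMin_pos hopt hm2 hm i)) Finset.univ_nonempty
  have hmax : 0 ≤ gapMax d K kstar := gapMax_nonneg
  set ε := s / 2 / (gapMax d K kstar + 1) with hε
  have hgapε : gapMax d K kstar * ε ≤ s / 2 := by
    rw [hε, mul_div_assoc', div_le_iff₀ (by positivity)]
    nlinarith
  set c := m * ((K - m + 1 : ℕ) : ℝ) ^ 2 + gapMax d K kstar * (3 * (m * ((K - m + 1) / 2 : ℕ)))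
  filter_upwards [eventually_expectation_not_positive_le (d := d) (ε := ε) hm (by positivity),
    tendsto_log_natCast_atTop.eventually_ge_atTop (c / (s / 2))] with T hT hc
  rw [div_le_iff₀' (by positivity)] at hc
  have hsum : ∑ i, ((K - m + 1 : ℕ) : ℝ) ^ 3 * Real.log T * invGapMin d K kstar i =
      s * Real.log T := by
    rw [hs, Finset.sum_mul]
    exact Finset.sum_congr rfl fun i _ => mul_right_comm _ _ _
  have hεlog := mul_le_mul_of_nonneg_right hgapε (Real.log_natCast_nonneg T)
  have hregret := regret_le_of_expectation_le hopt hm2 hm hT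
  rw [hsum] at hregret ⊢
  linarith

end AsymptoticRegret

end CommunityExploration

theorem theorem3 :
    ∃ C : ℝ, 0 < C ∧
      ∀ (m : ℕ) [NeZero m] (K : ℕ) (d : Fin m → ℕ+) (kstar : Fin m → ℕ),
        m < K → CommunityExploration.IsOptimalAllocation d K kstar →
          (∀ T : ℕ, 1 ≤ T →
            CommunityExploration.regret d K kstar T ≤
              (∑ i, 48 * ((K - m + 1).choose 2 : ℝ) * (K : ℝ) * Real.log T *
                  CommunityExploration.invGapMin d K kstar i)
                + 2 * ((K - m + 1).choose 2 : ℝ) * (m : ℝ)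
                + (((K - m + 1) / 2 : ℕ) : ℝ) * Real.pi ^ 2 / 3 * (m : ℝ) *
                    CommunityExploration.gapMax d K kstar) ∧
          (∀ᶠ T : ℕ in Filter.atTop,
            CommunityExploration.regret d K kstar T ≤
              C * ∑ i, ((K - m + 1 : ℕ) : ℝ) ^ 3 * Real.log T *
                  CommunityExploration.invGapMin d K kstar i) := by
  exact ⟨13, by norm_num, fun m _ K d kstar hm hopt =>
    ⟨fun T hT => CommunityExploration.regret_le_log hopt hm hT,
      CommunityExploration.eventually_regret_le hopt hm⟩⟩
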